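/- Let $d>0$, $K>0$, and let $b:[0,\infty)\to[0,\infty)$ satisfy (B) $b(0)=0$, $b(K)=dK$, $b(u)>du$ for $u\in(0,K)$, and $0<b(u)<du$ for $u>K$; (C1) $b$ is $C^1$ on $[0,\infty)$; (C2) $b'(0)>d$ and $b(u)<b'(0)u$ for $u>0$; (C3) there is $L>0$ with $0\le b'(0)u-b(u)<Lu^2$ for $u\in(0,K]$, and $|b'(u)|\le b'(0)$ for $u\in[0,K]$. Let $\tau:[0,\infty)\to[0,\infty)$ be $C^1$ with $0\le\tau'(u)<1$ for $u\ge0$ and $\lim_{u\to\infty}\tau(u)<\infty$, and put $m=\tau(0)$. For $c>0$ consider $$\phi''(\xi)-c\,\phi'(\xi)-d\,\phi(\xi)+b\bigl(\phi(\xi-c\,\tau(\phi(\xi)))\bigr)=0,\qquad \xi\in\mathbb R, \tag{2}$$ where a solution is a function $\phi\in C^2(\mathbb R,\mathbb R)$. Put $$\Lambda(\lambda,c)=\lambda^2-c\lambda-d+b'(0)e^{-\lambda c m},\qquad \mathcal K=\frac1d\max_{u\in[0,K]}b(u).$$ (i) There is exactly one number $c^*>0$ such that $\Lambda(\lambda,c)>0$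 for all $c\in[0,c^*)$ and $\lambda\ge0$, while for every $c>c^*$ there are $0<\lambda_1<\lambda_2$ with $\Lambda(\lambda_1,c)=\Lambda(\lambda_2,c)=0$, $\Lambda(\cdot,c)<0$ on $(\lambda_1,\lambda_2)$ and $\Lambda(\cdot,c)>0$ on $[0,\lambda_1)\cup(\lambda_2,\infty)$. There is exactly one number $k\in(0,K]$ such that $\min_{v\in[k,\mathcal K]}b(v)=dk$. (ii) At $c=c^*$ equation (2) has a nonconstant positive solution $\phi$ that is bounded near $+\infty$ and satisfies $$k\le\liminf_{\xi\to+\infty}\phi(\xi)\le\limsup_{\xi\to+\infty}\phi(\xi)\le\mathcal K .$$ Moreover such a solution is obtained as a limit from larger speeds: for every nonincreasing sequence $c_n\to c^*$ with $c_n>c^*$ for all $n$, there are such a solution $\phi$, a subsequence $(c_{n_j})$, and positive solutions $\phi_j$ of (2) with $c=c_{n_j}$, bounded near $+\infty$, satisfying $\lim_{\xi\to-\infty}\phi_j(\xi)=0$ and $k\le\liminf_{\xi\to+\infty}\phi_j\le\limsup_{\xi\to+\infty}\phi_j\le\mathcal K$, such that $\phi_j\to\phi$ uniformly on every bounded interval.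 -/

import Mathlib

open Filter Topology Set

noncomputable section

/-- Standing assumptions on the birth function `b : [0,∞) → [0,∞)` with death rate `d` and
positive equilibrium `K`. Only the values of `b` on `[0,∞)` matter; the derivative on `[0,∞)`
is `derivWithin b (Ici 0)`, one-sided at the origin. -/
structure BirthAssumptions (d K : ℝ) (b : ℝ → ℝ) : Prop where
  d_pos : 0 < d
  K_pos : 0 < K
  nonneg : ∀ u, 0 ≤ u → 0 ≤ b u
  at_zero : b 0 = 0
  at_K : b K = d * K
  above_line : ∀ u, 0 < u → u < K → d * u < b u
  below_line : ∀ u, K < u → 0 < b u ∧ b u < d * u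
  contDiffOn : ContDiffOn ℝ 1 b (Ici 0)
  d_lt_deriv_zero : d < derivWithin b (Ici 0) 0
  lt_linear : ∀ u, 0 < u → b u < derivWithin b (Ici 0) 0 * u
  quadratic : ∃ L : ℝ, 0 < L ∧ ∀ u, 0 < u → u ≤ K →
    0 ≤ derivWithin b (Ici 0) 0 * u - b u ∧ derivWithin b (Ici 0) 0 * u - b u < L * u ^ 2
  deriv_bound : ∀ u, 0 ≤ u → u ≤ K → |derivWithin b (Ici 0) u| ≤ derivWithin b (Ici 0) 0

/-- Standing assumptions on the delay `τ : [0,∞) → [0,∞)`. -/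
structure DelayAssumptions (τ : ℝ → ℝ) : Prop where
  nonneg : ∀ u, 0 ≤ u → 0 ≤ τ u
  contDiffOn : ContDiffOn ℝ 1 τ (Ici 0)
  deriv_mem : ∀ u, 0 ≤ u → 0 ≤ derivWithin τ (Ici 0) u ∧ derivWithin τ (Ici 0) u < 1
  limit : ∃ M : ℝ, Tendsto τ atTop (𝓝 M)

/-- `φ` is a `C²` solution on the whole line of the wave profile equation
`φ''(ξ) - c φ'(ξ) - d φ(ξ) + b(φ(ξ - c τ(φ(ξ)))) = 0`. -/
def IsWaveProfile (d : ℝ) (b τ : ℝ → ℝ) (c : ℝ) (φ : ℝ → ℝ) : Prop :=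
  ContDiff ℝ 2 φ ∧
    ∀ ξ : ℝ, deriv (deriv φ) ξ - c * deriv φ ξ - d * φ ξ + b (φ (ξ - c * τ (φ ξ))) = 0

/-- The characteristic function `Λ(lam, c) = lam² - c lam - d + p exp(-lam c m)` of the
linearization at zero, where `p = b'(0)` and `m = τ(0)`. -/
def charFn (d p m lam c : ℝ) : ℝ :=
  lam ^ 2 - c * lam - d + p * Real.exp (-(lam * c * m))

/-- The defining property of the threshold speed `c*`. -/
structure IsCriticalSpeed (d p m cstar : ℝ) : Prop where
  pos : 0 < cstar
  below : ∀ c, 0 ≤ c → c < cstar → ∀ lam, 0 ≤ lam → 0 < charFn d p m lam c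
  above : ∀ c, cstar < c → ∃ lam₁ lam₂ : ℝ, 0 < lam₁ ∧ lam₁ < lam₂ ∧
    charFn d p m lam₁ c = 0 ∧ charFn d p m lam₂ c = 0 ∧
    (∀ lam, lam₁ < lam → lam < lam₂ → charFn d p m lam c < 0) ∧
    (∀ lam, 0 ≤ lam → (lam < lam₁ ∨ lam₂ < lam) → 0 < charFn d p m lam c)

/-- The upper level: the maximum of `b` over `[0,K]`, divided by `d`. -/
def upperLevel (d K : ℝ) (b : ℝ → ℝ) : ℝ := sSup (b '' Icc 0 K) / d

/-- The lower monotone envelope: the minimum of `b` over `[u, R]`. -/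
def lowerEnvelope (b : ℝ → ℝ) (R u : ℝ) : ℝ := sInf (b '' Icc u R)

/-- The defining property of the lower level `k`: it is a number in `(0,K]` at which the
lower monotone envelope of `b` meets the line `d u`. -/
def IsLowerLevel (d K : ℝ) (b : ℝ → ℝ) (k : ℝ) : Prop :=
  0 < k ∧ k ≤ K ∧ lowerEnvelope b (upperLevel d K b) k = d * k

/-- `lo ≤ liminf φ ≤ limsup φ ≤ hi` at `+∞`, where `φ` is bounded near `+∞`, so that the
real-valued `liminf` and `limsup` are the true ones. -/
def LimitsBetween (lo hi : ℝ) (φ : ℝ → ℝ) : Prop :=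
  IsBoundedUnder (· ≤ ·) atTop φ ∧ IsBoundedUnder (· ≥ ·) atTop φ ∧
    lo ≤ liminf φ atTop ∧ liminf φ atTop ≤ limsup φ atTop ∧ limsup φ atTop ≤ hi

end

/-! ### The threshold speed -/

/-! Write `p = b'(0)`, `m = τ(0)` and `U` for `upperLevel`. The characteristic function is strictly
convex in `lam`, positive at `lam = 0`, and strictly decreasing in `c` for `lam > 0`; hence `c*` is
the infimum of the speeds at which it takes a negative value.

For `c > c*` let `l` be the smaller root. Waves are sought between the barriers `min(e^{lx}, U)` and
`max(0, e^{lx} - q e^{γx})`, with `γ` slightly above `l` and `q` large. Neither `b` nor the equation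
is monotone, and the delay depends on the state, but no fixed point theorem is needed. If the
forcing is projected between the barriers and read with an extra delay `ε`, the equation on a
compact interval is solved by the method of steps, and the right boundary value is attained by
shooting with one real parameter (`exists_delayed_bvp`). The maximum principle then puts the
solution between the barriers (`between_barriers`). As `ε → 0` and the intervals exhaust the line,
compactness gives a wave and the projection becomes inactive (`exists_wave`).

A positive wave bounded by `U` cannot stay below the level `k`: where a limit of translates attains
the liminf, birth is at most death, which forces the value to be at least `k` (`le_liminf`). So
every wave above `c*` can be translated to have the value `k/2` at the origin. This normalization
survives the limit `c → c*`. The limit is therefore nonzero, hence positive, persistence applies to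
it as well, and it is not constant because it equals `k/2 < k` at the origin. -/

theorem strictConvexOn_charFn (d p m c : ℝ) (hp : 0 ≤ p) :
    StrictConvexOn ℝ univ fun lam => charFn d p m lam c := by
  have h1 : StrictConvexOn ℝ univ fun x : ℝ => x ^ 2 :=
    Even.strictConvexOn_pow (by decide) (by decide)
  have h2 : ConvexOn ℝ univ fun x : ℝ => p * Real.exp (-(x * c * m)) + (-(c * x) - d) := by
    refine ConvexOn.add ?_ ?_
    · have h := (convexOn_exp.comp_linearMap ((-(c * m)) • (LinearMap.id : ℝ →ₗ[ℝ] ℝ))).smul hp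
      refine (h.congr ?_).subset (by simp) convex_univ
      intro x _
      simp only [Function.comp, smul_eq_mul, LinearMap.smul_apply, LinearMap.id_apply]
      congr 2
      ring
    · refine ⟨convex_univ, fun x _ y _ a b _ _ hab => le_of_eq ?_⟩
      simp only [smul_eq_mul]
      linear_combination d * hab
  have h3 := h1.add_convexOn h2
  refine h3.congr ?_
  intro x _
  simp only [charFn, Pi.add_apply]
  ring

theorem continuous_charFn (d p m c : ℝ) : Continuous fun lam => charFn d p m lam c := by
  unfold charFn; fun_prop

theorem charFn_lt_of_lt {d p m c c' lam : ℝ} (hp : 0 ≤ p) (hm : 0 ≤ m) (hlam : 0 < lam)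
    (h : c < c') : charFn d p m lam c' < charFn d p m lam c := by
  have h1 : Real.exp (-(lam * c' * m)) ≤ Real.exp (-(lam * c * m)) := by
    apply Real.exp_le_exp.2
    have : lam * c * m ≤ lam * c' * m := by gcongr
    linarith
  have h2 := mul_le_mul_of_nonneg_left h1 hp
  have h3 : c * lam < c' * lam := by gcongr
  unfold charFn
  linarith

theorem charFn_zero (d p m c : ℝ) : charFn d p m 0 c = p - d := by
  unfold charFn; simp; ring

/-- From `e^{-x} ≥ 1 - x` the function dominates the quadratic `lam² - c(1 + pm) lam + (p - d)`,
whose discriminant is negative by `hc`. This keeps `c*` away from zero. -/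
theorem charFn_pos_of_small {d p m c lam : ℝ} (hp : 0 ≤ p)
    (hc : (c * (1 + p * m)) ^ 2 < 4 * (p - d)) :
    0 < charFn d p m lam c := by
  have h1 : 1 - lam * c * m ≤ Real.exp (-(lam * c * m)) := by
    have := Real.add_one_le_exp (-(lam * c * m)); linarith
  have h2 := mul_le_mul_of_nonneg_left h1 hp
  unfold charFn
  nlinarith [sq_nonneg (lam - c * (1 + p * m) / 2)]

theorem exists_roots_of_charFn_neg {d p m c lam : ℝ} (hp : 0 ≤ p) (hdp : d < p)
    (hlam : 0 ≤ lam) (h : charFn d p m lam c < 0) :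
    ∃ lam₁ lam₂ : ℝ, 0 < lam₁ ∧ lam₁ < lam₂ ∧
      charFn d p m lam₁ c = 0 ∧ charFn d p m lam₂ c = 0 ∧
      (∀ x, lam₁ < x → x < lam₂ → charFn d p m x c < 0) ∧
      (∀ x, 0 ≤ x → (x < lam₁ ∨ lam₂ < x) → 0 < charFn d p m x c) := by
  have h0 : 0 < charFn d p m 0 c := by rw [charFn_zero]; linarith
  have hcont := continuous_charFn d p m c
  obtain ⟨x₁, hx₁, hx₁0⟩ := intermediate_value_Icc' hlam hcont.continuousOn ⟨h.le, h0.le⟩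
  -- At `R` the term `R²` exceeds `cR + d`, so the sign is positive again to the right of `lam`.
  set R := lam + |c| + |d| + 1 with hR
  have hRpos : 0 < charFn d p m R c := by
    have h1 : 0 ≤ p * Real.exp (-(R * c * m)) := by positivity
    have h2 : c ≤ |c| := le_abs_self c
    have h3 : d ≤ |d| := le_abs_self d
    have h4 : 1 ≤ R := by rw [hR]; linarith [abs_nonneg c, abs_nonneg d]
    have h5 : |c| + |d| + 1 ≤ R := by rw [hR]; linarith
    unfold charFn
    nlinarith [mul_le_mul_of_nonneg_left h2 (by linarith : (0:ℝ) ≤ R),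
      mul_le_mul_of_nonneg_left h5 (by linarith : (0:ℝ) ≤ R), abs_nonneg d, abs_nonneg c]
  have hlR : lam ≤ R := by rw [hR]; linarith [abs_nonneg c, abs_nonneg d]
  obtain ⟨x₂, hx₂, hx₂0⟩ := intermediate_value_Icc hlR hcont.continuousOn ⟨h.le, hRpos.le⟩
  simp only at hx₁0 hx₂0
  have hx₁l : x₁ < lam := lt_of_le_of_ne hx₁.2 (by rintro rfl; linarith)
  have hx₂l : lam < x₂ := lt_of_le_of_ne hx₂.1 (by rintro rfl; linarith)
  have hx₁p : 0 < x₁ := lt_of_le_of_ne hx₁.1 (by rintro rfl; linarith)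
  have hconv := strictConvexOn_charFn d p m c hp
  -- Strict convexity in this form fixes the sign on all three intervals cut out by the two zeros.
  have key : ∀ x y z : ℝ, x < y → y < z →
      charFn d p m y c < max (charFn d p m x c) (charFn d p m z c) := fun x y z hxy hyz =>
    hconv.lt_on_openSegment (mem_univ _) (mem_univ _) (hxy.trans hyz).ne
      (by rw [openSegment_eq_Ioo (hxy.trans hyz)]; exact ⟨hxy, hyz⟩)
  refine ⟨x₁, x₂, hx₁p, hx₁l.trans hx₂l, hx₁0, hx₂0, fun x h1 h2 => ?_, fun x _ hx => ?_⟩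
  · simpa [hx₁0, hx₂0] using key _ _ _ h1 h2
  · by_contra! hneg
    rcases hx with hx | hx
    · have := key x x₁ lam hx hx₁l
      rw [hx₁0] at this
      exact absurd this (not_lt.2 (max_le hneg h.le))
    · have := key lam x₂ x hx₂l hx
      rw [hx₂0] at this
      exact absurd this (not_lt.2 (max_le h.le hneg))

theorem existsUnique_isCriticalSpeed {d p m : ℝ} (hd : 0 < d) (hdp : d < p) (hm : 0 ≤ m) :
    ∃! cstar : ℝ, IsCriticalSpeed d p m cstar := by
  have hp : 0 ≤ p := by linarith
  set S : Set ℝ := {c | 0 ≤ c ∧ ∃ lam, 0 ≤ lam ∧ charFn d p m lam c < 0} with hS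
  have hne : S.Nonempty := by
    refine ⟨p + 1, by linarith, 1, by norm_num, ?_⟩
    have h1 : Real.exp (-(1 * (p + 1) * m)) ≤ 1 := by
      apply Real.exp_le_one_iff.2
      have : 0 ≤ 1 * (p + 1) * m := by positivity
      linarith
    have := mul_le_mul_of_nonneg_left h1 hp
    unfold charFn
    linarith
  have hbdd : BddBelow S := ⟨0, fun c hc => hc.1⟩
  have hposS : ∀ lam c, 0 ≤ lam → charFn d p m lam c ≤ 0 → 0 < lam := fun lam c h0 h => by
    refine lt_of_le_of_ne h0 ?_
    rintro rfl
    rw [charFn_zero] at h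
    linarith
  have hcrit : IsCriticalSpeed d p m (sInf S) := by
    refine ⟨?_, ?_, ?_⟩
    · set δ := Real.sqrt (p - d) / (1 + p * m) with hδ
      have hpm : 0 < 1 + p * m := by positivity
      have hs : 0 < Real.sqrt (p - d) := Real.sqrt_pos.2 (by linarith)
      have hδ0 : 0 < δ := by positivity
      refine lt_of_lt_of_le hδ0 (le_csInf hne fun c hc => ?_)
      by_contra! hlt
      obtain ⟨hc0, lam, -, hneg⟩ := hc
      refine absurd (charFn_pos_of_small (lam := lam) hp ?_) (not_lt.2 hneg.le)
      have h1 : c * (1 + p * m) ≤ Real.sqrt (p - d) := by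
        rw [hδ, lt_div_iff₀ hpm] at hlt
        exact hlt.le
      have h2 : (c * (1 + p * m)) ^ 2 ≤ Real.sqrt (p - d) ^ 2 := by gcongr
      rw [Real.sq_sqrt (by linarith)] at h2
      linarith
    · intro c hc0 hc lam hlam
      by_contra! hneg
      have hl := hposS lam c hlam hneg
      -- Strict monotonicity in the speed makes the value strictly negative at a slightly larger
      -- speed that is still below the infimum.
      obtain ⟨c', h1, h2⟩ := exists_between hc
      exact absurd (csInf_le hbdd (show c' ∈ S from ⟨by linarith, lam, hlam,
        (charFn_lt_of_lt hp hm hl h1).trans_le hneg⟩)) (not_le.2 h2)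
    · intro c hc
      obtain ⟨c', ⟨_, lam, hlam, hneg⟩, hlt⟩ := exists_lt_of_csInf_lt hne hc
      have hl := hposS lam c' hlam hneg.le
      exact exists_roots_of_charFn_neg hp hdp hlam ((charFn_lt_of_lt hp hm hl hlt).trans hneg)
  have aux : ∀ x y, IsCriticalSpeed d p m x → IsCriticalSpeed d p m y → ¬ x < y := by
    intro x y hx hy hxy
    obtain ⟨c, h1, h2⟩ := exists_between hxy
    obtain ⟨l₁, _, hl₁, _, hz, _⟩ := hx.above c h1
    have := hy.below c (hx.pos.le.trans h1.le) h2 l₁ hl₁.le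
    linarith
  exact ⟨_, hcrit, fun y hy => le_antisymm (not_lt.1 (aux _ _ hcrit hy)) (not_lt.1 (aux _ _ hy hcrit))⟩

/-! ### The two levels -/

namespace BirthAssumptions

variable {d K : ℝ} {b : ℝ → ℝ}

theorem continuousOn (hb : BirthAssumptions d K b) : ContinuousOn b (Ici 0) :=
  hb.contDiffOn.continuousOn

theorem d_mul_le (hb : BirthAssumptions d K b) {u : ℝ} (h0 : 0 ≤ u) (h1 : u ≤ K) :
    d * u ≤ b u := by
  rcases h0.eq_or_lt with rfl | h0
  · simp [hb.at_zero]
  rcases h1.eq_or_lt with rfl | h1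
  · exact hb.at_K.ge
  · exact (hb.above_line u h0 h1).le

theorem pos (hb : BirthAssumptions d K b) {u : ℝ} (h0 : 0 < u) : 0 < b u := by
  rcases le_or_gt u K with h | h
  · exact (mul_pos hb.d_pos h0).trans_le (hb.d_mul_le h0.le h)
  · exact (hb.below_line u h).1

theorem le_upperLevel_of_le_K (hb : BirthAssumptions d K b) {u : ℝ} (h0 : 0 ≤ u) (h1 : u ≤ K) :
    b u ≤ d * upperLevel d K b := by
  have hcomp : IsCompact (b '' Icc 0 K) :=
    isCompact_Icc.image_of_continuousOn (hb.continuousOn.mono fun x hx => hx.1)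
  have := le_csSup hcomp.bddAbove (mem_image_of_mem b (⟨h0, h1⟩ : u ∈ Icc 0 K))
  unfold upperLevel
  rwa [mul_div_cancel₀ _ hb.d_pos.ne']

theorem K_le_upperLevel (hb : BirthAssumptions d K b) : K ≤ upperLevel d K b := by
  have := hb.le_upperLevel_of_le_K hb.K_pos.le le_rfl
  rw [hb.at_K] at this
  exact le_of_mul_le_mul_left this hb.d_pos

/-- Beyond `K` the birth rate lies below the line `du`. This bound makes the constant `U` a
supersolution. -/
theorem le_upperLevel (hb : BirthAssumptions d K b) {u : ℝ} (h0 : 0 ≤ u)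
    (h1 : u ≤ upperLevel d K b) : b u ≤ d * upperLevel d K b := by
  rcases le_or_gt u K with h | h
  · exact hb.le_upperLevel_of_le_K h0 h
  · exact (hb.below_line u h).2.le.trans (mul_le_mul_of_nonneg_left h1 hb.d_pos.le)

theorem exists_isMinOn_Icc (hb : BirthAssumptions d K b) {u : ℝ} (h0 : 0 ≤ u) (h1 : u ≤ K) :
    ∃ v ∈ Icc u (upperLevel d K b), b v = lowerEnvelope b (upperLevel d K b) u ∧
      ∀ w ∈ Icc u (upperLevel d K b), b v ≤ b w := by
  have hcomp : IsCompact (b '' Icc u (upperLevel d K b)) :=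
    isCompact_Icc.image_of_continuousOn (hb.continuousOn.mono fun x hx => h0.trans hx.1)
  have hne : (b '' Icc u (upperLevel d K b)).Nonempty :=
    (nonempty_Icc.2 (h1.trans hb.K_le_upperLevel)).image _
  obtain ⟨v, hv, hvb⟩ := hcomp.sInf_mem hne
  refine ⟨v, hv, hvb, fun w hw => ?_⟩
  rw [hvb]
  exact csInf_le hcomp.bddBelow (mem_image_of_mem b hw)

/-- The level is `min b / d` with the minimum over `[K, U]`: on `[k, K]` one has `b(w) ≥ dw ≥ dk`,
so enlarging the interval to `[k, U]` does not lower the minimum. For two levels `x < y`, the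
minimizer over `[x, U]` would lie below `y ≤ K`, where `b(v) > dv ≥ dx`. -/
theorem existsUnique_isLowerLevel (hb : BirthAssumptions d K b) :
    ∃! k : ℝ, IsLowerLevel d K b k := by
  have hd := hb.d_pos
  obtain ⟨v, hv, -, hmin⟩ := hb.exists_isMinOn_Icc hb.K_pos.le le_rfl
  have hv0 : 0 < v := hb.K_pos.trans_le hv.1
  have hvK : b v ≤ d * K := hb.at_K ▸ hmin K ⟨le_rfl, hb.K_le_upperLevel⟩
  have hlev : IsLowerLevel d K b (b v / d) := by
    have hkK : b v / d ≤ K := by rw [div_le_iff₀ hd]; linarith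
    have hk0 : 0 < b v / d := div_pos (hb.pos hv0) hd
    refine ⟨hk0, hkK, ?_⟩
    obtain ⟨w, hw, hweq, hwmin⟩ := hb.exists_isMinOn_Icc hk0.le hkK
    rw [← hweq, mul_div_cancel₀ _ hd.ne']
    refine le_antisymm (hwmin v ⟨hkK.trans hv.1, hv.2⟩) ?_
    rcases le_or_gt w K with h | h
    · have h1 := hb.d_mul_le (hk0.le.trans hw.1) h
      have h2 := mul_le_mul_of_nonneg_left hw.1 hd.le
      rw [mul_div_cancel₀ _ hd.ne'] at h2
      linarith
    · exact hmin w ⟨h.le, hw.2⟩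
  have aux : ∀ x y, IsLowerLevel d K b x → IsLowerLevel d K b y → ¬ x < y := by
    intro x y hx hy hxy
    obtain ⟨v, hv, hveq, -⟩ := hb.exists_isMinOn_Icc hx.1.le hx.2.1
    obtain ⟨w, hw, hweq, hwmin⟩ := hb.exists_isMinOn_Icc hy.1.le hy.2.1
    rw [hx.2.2] at hveq
    rw [hy.2.2] at hweq
    have hlt : d * x < d * y := by gcongr
    have hvy : v < y := by
      by_contra! h
      have := hwmin v ⟨h, hv.2⟩
      linarith
    have h1 := hb.above_line v (hx.1.trans_le hv.1) (hvy.trans_le hy.2.1)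
    have h2 := mul_le_mul_of_nonneg_left hv.1 hd.le
    linarith
  exact ⟨_, hlev, fun y hy => le_antisymm (not_lt.1 (aux _ _ hlev hy)) (not_lt.1 (aux _ _ hy hlev))⟩

theorem le_of_isLowerLevel (hb : BirthAssumptions d K b) {k u : ℝ} (hk : IsLowerLevel d K b k)
    (h1 : k ≤ u) (h2 : u ≤ upperLevel d K b) : d * k ≤ b u := by
  obtain ⟨v, _, hveq, hmin⟩ := hb.exists_isMinOn_Icc hk.1.le hk.2.1
  rw [hk.2.2] at hveq
  exact hveq ▸ hmin u ⟨h1, h2⟩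

/-- If the birth rate at `v ≥ u` does not exceed the death rate at `u`, then `u` is at least the
lower level. -/
theorem lowerLevel_le (hb : BirthAssumptions d K b) {k u v : ℝ} (hk : IsLowerLevel d K b k)
    (hu : 0 < u) (huv : u ≤ v) (hv : v ≤ upperLevel d K b) (h : b v ≤ d * u) : k ≤ u := by
  have hd := hb.d_pos
  rcases lt_or_ge v K with hvK | hvK
  · have h1 := hb.above_line v (hu.trans_le huv) hvK
    have h2 := mul_le_mul_of_nonneg_left huv hd.le
    linarith
  · exact le_of_mul_le_mul_left ((hb.le_of_isLowerLevel hk (hk.2.1.trans hvK) hv).trans h) hd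

/-- A quadratic lower bound valid on the whole half-line. -/
theorem exists_quadratic_le (hb : BirthAssumptions d K b) :
    ∃ L : ℝ, 0 < L ∧ ∀ u, 0 ≤ u → derivWithin b (Ici 0) 0 * u - L * u ^ 2 ≤ b u := by
  obtain ⟨L, hL, hq⟩ := hb.quadratic
  have hp : 0 < derivWithin b (Ici 0) 0 := hb.d_pos.trans hb.d_lt_deriv_zero
  have hK := hb.K_pos
  -- The extra `p / K` makes the left side nonpositive for `u > K`, where only `b ≥ 0` is available.
  refine ⟨L + derivWithin b (Ici 0) 0 / K, by positivity, fun u hu => ?_⟩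
  have h2 : 0 ≤ derivWithin b (Ici 0) 0 / K * u ^ 2 := by positivity
  rcases hu.eq_or_lt with rfl | hu0
  · simp [hb.at_zero]
  rcases le_or_gt u K with h | h
  · have := (hq u hu0 h).2
    nlinarith
  · have h1 := hb.nonneg u hu
    have h3 : derivWithin b (Ici 0) 0 * u ≤ derivWithin b (Ici 0) 0 / K * u ^ 2 := by
      rw [div_mul_eq_mul_div, le_div_iff₀ hK]
      nlinarith [mul_pos hp hu0]
    have h4 : 0 ≤ L * u ^ 2 := by positivity
    linarith

theorem le_linear (hb : BirthAssumptions d K b) {u : ℝ} (h0 : 0 ≤ u) :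
    b u ≤ derivWithin b (Ici 0) 0 * u := by
  rcases h0.eq_or_lt with rfl | h0
  · simp [hb.at_zero]
  · exact (hb.lt_linear u h0).le

end BirthAssumptions

/-! ### Elementary bounds on the delay. -/

namespace DelayAssumptions

variable {τ : ℝ → ℝ}

theorem differentiableOn (hτ : DelayAssumptions τ) : DifferentiableOn ℝ τ (Ici 0) :=
  hτ.contDiffOn.differentiableOn (by norm_num)

theorem deriv_mem_of_pos (hτ : DelayAssumptions τ) {u : ℝ} (hu : 0 < u) :
    0 ≤ deriv τ u ∧ deriv τ u < 1 := by
  have := hτ.deriv_mem u hu.le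
  rwa [derivWithin_of_mem_nhds (Ici_mem_nhds hu)] at this

theorem zero_le_apply (hτ : DelayAssumptions τ) {u : ℝ} (hu : 0 ≤ u) : τ 0 ≤ τ u := by
  have hmono : MonotoneOn τ (Ici 0) := by
    refine monotoneOn_of_deriv_nonneg (convex_Ici 0) hτ.contDiffOn.continuousOn ?_ ?_
    · exact hτ.differentiableOn.mono interior_subset
    · intro x hx
      rw [interior_Ici] at hx
      exact (hτ.deriv_mem_of_pos hx).1
  exact hmono self_mem_Ici hu hu

/-- Replacing the delay by its value at zero costs at most `u`, hence a quadratic error in the small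
wave. -/
theorem apply_le (hτ : DelayAssumptions τ) {u : ℝ} (hu : 0 ≤ u) : τ u ≤ τ 0 + u := by
  have := Convex.image_sub_le_mul_sub_of_deriv_le (convex_Ici (0 : ℝ))
    hτ.contDiffOn.continuousOn (hτ.differentiableOn.mono interior_subset) (C := 1)
    (fun x hx => by
      rw [interior_Ici] at hx
      exact (hτ.deriv_mem_of_pos hx).2.le) 0 self_mem_Ici u hu hu
  linarith

end DelayAssumptions

/-! ### Second-derivative tests and maximum principles -/

/-- At a critical point that is a minimum from the left the second derivative is nonnegative. -/
theorem second_deriv_nonneg_of_left_min {f f' : ℝ → ℝ} {x m a : ℝ}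
    (hf : ∀ y, HasDerivAt f (f' y) y) (hf' : HasDerivAt f' m x) (h0 : f' x = 0)
    (hax : a < x) (hmin : ∀ y ∈ Icc a x, f x ≤ f y) : 0 ≤ m := by
  by_contra! hm
  have hslope := (hasDerivAt_iff_tendsto_slope.1 hf').eventually (gt_mem_nhds hm)
  have hleft : ∀ᶠ y in 𝓝[<] x, slope f' x y < 0 :=
    hslope.filter_mono (nhdsWithin_mono _ fun y (hy : y < x) => hy.ne)
  obtain ⟨l, hl, hlx⟩ := (mem_nhdsLT_iff_exists_Ioo_subset' hax).1 hleft
  obtain ⟨y, hy1, hy2⟩ := exists_between (max_lt hl hax)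
  have hcont : Continuous f := continuous_iff_continuousAt.2 fun y => (hf y).continuousAt
  have hmono : StrictMonoOn f (Icc y x) := by
    refine strictMonoOn_of_deriv_pos (convex_Icc y x) hcont.continuousOn fun z hz => ?_
    rw [interior_Icc] at hz
    have hz' : slope f' x z < 0 := hlx ⟨((le_max_left l a).trans_lt hy1).trans hz.1, hz.2⟩
    rw [slope_def_field, h0, sub_zero, div_neg_iff] at hz'
    rw [(hf z).deriv]
    rcases hz' with h | h
    · exact h.1
    · linarith [hz.2, h.2]
  have h1 := hmono ⟨le_rfl, hy2.le⟩ ⟨hy2.le, le_rfl⟩ hy2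
  exact absurd (hmin y ⟨(le_max_right l a).trans hy1.le, hy2.le⟩) (not_le.2 h1)

/-- The weak maximum principle on a compact interval; the differential inequality is only needed
where the function is negative. -/
theorem nonneg_of_supersolution {w w' w'' : ℝ → ℝ} {a B c d : ℝ} (hd : 0 < d) (haB : a ≤ B)
    (hw : ∀ x, HasDerivAt w (w' x) x) (hw' : ∀ x, HasDerivAt w' (w'' x) x)
    (hsup : ∀ x ∈ Ioo a B, w x < 0 → w'' x - c * w' x - d * w x ≤ 0)
    (ha : 0 ≤ w a) (hB : 0 ≤ w B) : ∀ x ∈ Icc a B, 0 ≤ w x := by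
  have hcont : Continuous w := continuous_iff_continuousAt.2 fun y => (hw y).continuousAt
  obtain ⟨z, hz, hmin⟩ := isCompact_Icc.exists_isMinOn (nonempty_Icc.2 haB) hcont.continuousOn
  intro x hx
  by_contra! hneg
  have hzneg : w z < 0 := (hmin hx).trans_lt hneg
  have hz1 : a < z := lt_of_le_of_ne hz.1 (by rintro rfl; linarith)
  have hz2 : z < B := lt_of_le_of_ne hz.2 (by rintro rfl; linarith)
  have hloc : IsLocalMin w z := hmin.isLocalMin (Icc_mem_nhds hz1 hz2)
  have h0 : w' z = 0 := hloc.hasDerivAt_eq_zero (hw z)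
  have h2 := second_deriv_nonneg_of_left_min hw (hw' z) h0 hz1
    fun y hy => hmin ⟨hy.1, hy.2.trans hz.2⟩
  have := hsup z ⟨hz1, hz2⟩ hzneg
  rw [h0] at this
  nlinarith [mul_neg_of_pos_of_neg hd hzneg]

/-- Roots of the polynomial `x² - c x - d`. -/
theorem exists_roots (c : ℝ) {d : ℝ} (hd : 0 < d) :
    ∃ μ₁ μ₂ : ℝ, μ₁ < 0 ∧ 0 < μ₂ ∧ μ₁ + μ₂ = c ∧ μ₁ * μ₂ = -d := by
  set r := Real.sqrt (c ^ 2 + 4 * d)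
  have hr : r ^ 2 = c ^ 2 + 4 * d := Real.sq_sqrt (by positivity)
  have hcr : |c| < r := by
    apply Real.lt_sqrt_of_sq_lt
    rw [sq_abs]
    linarith
  obtain ⟨h1, h2⟩ := abs_lt.1 hcr
  exact ⟨(c - r) / 2, (c + r) / 2, by linarith, by linarith, by ring, by nlinarith⟩

/-- The strong maximum principle: a nonnegative supersolution on the line that vanishes somewhere
vanishes identically. -/
theorem eq_zero_of_supersolution {w w' w'' : ℝ → ℝ} {c d x₀ : ℝ} (hd : 0 < d)
    (hw : ∀ x, HasDerivAt w (w' x) x) (hw' : ∀ x, HasDerivAt w' (w'' x) x)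
    (hsup : ∀ x, w'' x - c * w' x - d * w x ≤ 0)
    (h0 : ∀ x, 0 ≤ w x) (hx₀ : w x₀ = 0) : ∀ x, w x = 0 := by
  obtain ⟨μ₁, μ₂, -, -, hs, hp⟩ := exists_roots c hd
  have hw'0 : w' x₀ = 0 := by
    have hloc : IsLocalMin w x₀ := Eventually.of_forall fun x => hx₀ ▸ h0 x
    exact hloc.hasDerivAt_eq_zero (hw x₀)
  have hexp : ∀ μ x : ℝ, HasDerivAt (fun x => Real.exp (-μ * x)) (Real.exp (-μ * x) * -μ) x :=
    fun μ x => by simpa using ((hasDerivAt_id x).const_mul (-μ)).exp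
  -- The operator factors as `(D - μ₁)(D - μ₂)`. The inner factor, suitably weighted, is antitone
  -- and vanishes at `x₀`, so `e^{-μ₂x} w` increases before `x₀` and decreases after it; its maximum
  -- is the value zero at `x₀`.
  have hv : ∀ x, HasDerivAt (fun x => Real.exp (-μ₁ * x) * (w' x - μ₂ * w x))
      (Real.exp (-μ₁ * x) * (w'' x - c * w' x - d * w x)) x := fun x => by
    refine ((hexp μ₁ x).mul ((hw' x).sub ((hw x).const_mul μ₂))).congr_deriv ?_
    rw [← hs, show d = -(μ₁ * μ₂) by linarith]
    simp only [Pi.sub_apply]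
    ring
  have hanti : Antitone fun x => Real.exp (-μ₁ * x) * (w' x - μ₂ * w x) :=
    antitone_of_hasDerivAt_nonpos hv fun x =>
      mul_nonpos_of_nonneg_of_nonpos (Real.exp_pos _).le (hsup x)
  have hz : ∀ x, HasDerivAt (fun x => Real.exp (-μ₂ * x) * w x)
      (Real.exp (-μ₂ * x) * (w' x - μ₂ * w x)) x := fun x => by
    refine ((hexp μ₂ x).mul (hw x)).congr_deriv ?_
    ring
  have hzc : Continuous fun x => Real.exp (-μ₂ * x) * w x :=
    continuous_iff_continuousAt.2 fun y => (hz y).continuousAt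
  have hzero : ∀ x, Real.exp (-μ₂ * x) * w x ≤ 0 := by
    intro x
    rcases le_total x₀ x with h | h
    · have hA : AntitoneOn (fun x => Real.exp (-μ₂ * x) * w x) (Ici x₀) := by
        refine antitoneOn_of_deriv_nonpos (convex_Ici x₀) hzc.continuousOn
          (fun y _ => (hz y).differentiableAt.differentiableWithinAt) fun y hy => ?_
        rw [interior_Ici] at hy
        rw [(hz y).deriv]
        have h1 := hanti (le_of_lt hy)
        simp only [hw'0, hx₀, mul_zero, sub_zero] at h1
        exact mul_nonpos_of_nonneg_of_nonpos (Real.exp_pos _).le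
          (nonpos_of_mul_nonpos_right h1 (Real.exp_pos _))
      simpa [hx₀] using hA self_mem_Ici h h
    · have hM : MonotoneOn (fun x => Real.exp (-μ₂ * x) * w x) (Iic x₀) := by
        refine monotoneOn_of_deriv_nonneg (convex_Iic x₀) hzc.continuousOn
          (fun y _ => (hz y).differentiableAt.differentiableWithinAt) fun y hy => ?_
        rw [interior_Iic] at hy
        rw [(hz y).deriv]
        have h1 := hanti (le_of_lt hy)
        simp only [hw'0, hx₀, mul_zero, sub_zero] at h1
        exact mul_nonneg (Real.exp_pos _).le (nonneg_of_mul_nonneg_right h1 (Real.exp_pos _))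
      simpa [hx₀] using hM h self_mem_Iic h
  exact fun x => le_antisymm (nonpos_of_mul_nonpos_right (hzero x) (Real.exp_pos _)) (h0 x)

/-- Interior derivative bound from bounds on the function and on `φ'' - c φ'`. -/
theorem abs_deriv_le {φ φ' φ'' : ℝ → ℝ} {c C M x : ℝ}
    (hφ : ∀ x, HasDerivAt φ (φ' x) x) (hφ' : ∀ x, HasDerivAt φ' (φ'' x) x)
    (hC : ∀ y ∈ Icc x (x + 1), |φ y| ≤ C) (hM : ∀ y ∈ Icc x (x + 1), |φ'' y - c * φ' y| ≤ M) :
    |φ' x| ≤ 2 * C + 2 * |c| * C + M := by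
  have hcont : Continuous φ := continuous_iff_continuousAt.2 fun y => (hφ y).continuousAt
  -- At some `y` within distance one the slope is at most `2C`; the `M`-Lipschitz function `φ' - cφ`
  -- carries this bound back to `x`.
  obtain ⟨y, hy, hyeq⟩ := exists_hasDerivAt_eq_slope φ φ' (lt_add_one x) hcont.continuousOn
    fun z _ => hφ z
  have hlip := (convex_Icc x (x + 1)).norm_image_sub_le_of_norm_hasDerivWithin_le
    (f := fun z => φ' z - c * φ z) (f' := fun z => φ'' z - c * φ' z) (C := M)
    (fun z _ => ((hφ' z).sub ((hφ z).const_mul c)).hasDerivWithinAt)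
    (fun z hz => hM z hz) (Ioo_subset_Icc_self hy) (left_mem_Icc.2 (by linarith))
  have hM0 : 0 ≤ M := (abs_nonneg _).trans (hM x (left_mem_Icc.2 (by linarith)))
  have h1 : M * ‖x - y‖ ≤ M := by
    refine mul_le_of_le_one_right hM0 ?_
    rw [Real.norm_eq_abs, abs_le]
    constructor <;> linarith [hy.1, hy.2]
  rw [Real.norm_eq_abs] at hlip
  have hx := hC x (left_mem_Icc.2 (by linarith))
  have hx1 := hC (x + 1) (right_mem_Icc.2 (by linarith))
  have hyC := hC y (Ioo_subset_Icc_self hy)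
  have hcy : |c * φ y| ≤ |c| * C := by rw [abs_mul]; gcongr
  have hcx : |c * φ x| ≤ |c| * C := by rw [abs_mul]; gcongr
  rw [add_sub_cancel_left, div_one] at hyeq
  have h2 := hlip.trans h1
  rw [abs_le] at *
  constructor <;> linarith [hx.1, hx.2, hx1.1, hx1.2, hcy.1, hcy.2, hcx.1, hcx.2, h2.1, h2.2]

/-! ### Compactness -/

/-- Arzelà–Ascoli in `C(ℝ, ℝ)`: the functions with these bounds are equicontinuous and form a closed
subset of a compact product of intervals. -/
theorem exists_subseq_tendstoLocallyUniformly_of_lipschitz {f : ℕ → ℝ → ℝ} {C R : ℝ}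
    (hC : ∀ n x, |f n x| ≤ C) (hR : ∀ n x y, |f n x - f n y| ≤ R * |x - y|) :
    ∃ (s : ℕ → ℕ) (g : ℝ → ℝ), StrictMono s ∧ Continuous g ∧
      TendstoLocallyUniformly (fun n => f (s n)) g atTop := by
  have hlip : ∀ g : ℝ → ℝ, (∀ x y, |g x - g y| ≤ R * |x - y|) →
      LipschitzWith (Real.toNNReal R) g := fun g hg =>
    LipschitzWith.of_dist_le_mul fun x y => by
      rw [Real.dist_eq, Real.dist_eq]
      exact (hg x y).trans (mul_le_mul_of_nonneg_right (Real.le_coe_toNNReal R) (abs_nonneg _))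
  set S : Set C(ℝ, ℝ) := {g | (∀ x, |g x| ≤ C) ∧ ∀ x y, |g x - g y| ≤ R * |x - y|} with hS
  have himage : ContinuousMap.toFun '' S =
      {g : ℝ → ℝ | (∀ x, |g x| ≤ C) ∧ ∀ x y, |g x - g y| ≤ R * |x - y|} := by
    ext g
    constructor
    · rintro ⟨h, hh, rfl⟩
      exact hh
    · exact fun hg => ⟨⟨g, (hlip g hg.2).continuous⟩, hg, rfl⟩
  have hcomp : IsCompact S := by
    refine ArzelaAscoli.isCompact_of_equicontinuous S ?_ ?_
    · rw [himage]
      refine (isCompact_univ_pi fun _ : ℝ => isCompact_Icc (a := -C) (b := C)).of_isClosed_subset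
        ?_ fun g hg x _ => abs_le.1 (hg.1 x)
      simp only [ofPred_and, ofPred_forall]
      refine (isClosed_iInter fun x => ?_).inter
        (isClosed_iInter fun x => isClosed_iInter fun y => ?_)
      · exact isClosed_le (by fun_prop) continuous_const
      · exact isClosed_le (by fun_prop) continuous_const
    · exact (LipschitzWith.uniformEquicontinuous (fun x : S => (x.1 : ℝ → ℝ)) (Real.toNNReal R)
        fun x => hlip _ x.2.2).equicontinuous
  obtain ⟨g, -, s, hs, hlim⟩ := hcomp.tendsto_subseq
    (x := fun n => (⟨f n, (hlip _ (hR n)).continuous⟩ : C(ℝ, ℝ))) fun n => ⟨hC n, hR n⟩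
  exact ⟨s, g, hs, g.continuous, ContinuousMap.tendsto_iff_tendstoLocallyUniformly.1 hlim⟩

/-- Functions that are bounded and Lipschitz on symmetric intervals exhausting the line have a
locally uniformly convergent subsequence. -/
theorem exists_subseq_tendstoLocallyUniformly {φ φ' : ℕ → ℝ → ℝ} {r : ℕ → ℝ} {C R : ℝ}
    (hφ : ∀ n x, HasDerivAt (φ n) (φ' n x) x) (hr0 : ∀ n, 0 ≤ r n) (hr : Tendsto r atTop atTop)
    (hC : ∀ n, ∀ x ∈ Icc (-r n) (r n), |φ n x| ≤ C)
    (hR : ∀ n, ∀ x ∈ Icc (-r n) (r n), |φ' n x| ≤ R) :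
    ∃ (s : ℕ → ℕ) (g : ℝ → ℝ), StrictMono s ∧ Continuous g ∧
      TendstoLocallyUniformly (fun n => φ (s n)) g atTop := by
  -- Clamping the argument gives globally Lipschitz functions that agree with the originals on any
  -- compact set from some index on.
  have hproj : ∀ n x, max (-r n) (min (r n) x) ∈ Icc (-r n) (r n) := fun n x =>
    ⟨le_max_left _ _, max_le (by linarith [hr0 n]) (min_le_left _ _)⟩
  have hR0 : 0 ≤ R := (abs_nonneg _).trans (hR 0 0 ⟨by linarith [hr0 0], hr0 0⟩)
  obtain ⟨s, g, hs, hg, hlim⟩ := exists_subseq_tendstoLocallyUniformly_of_lipschitz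
    (f := fun n x => φ n (max (-r n) (min (r n) x))) (C := C) (R := R)
    (fun n x => hC n _ (hproj n x)) (fun n x y => by
      have h1 := (convex_Icc (-r n) (r n)).norm_image_sub_le_of_norm_hasDerivWithin_le
        (fun z _ => (hφ n z).hasDerivWithinAt) (fun z hz => hR n z hz) (hproj n y) (hproj n x)
      refine h1.trans (mul_le_mul_of_nonneg_left ?_ hR0)
      rw [Real.norm_eq_abs]
      exact (abs_max_sub_max_le_max _ _ _ _).trans (max_le (by simp)
        ((abs_min_sub_min_le_max _ _ _ _).trans (by simp))))
  refine ⟨s, g, hs, hg, ?_⟩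
  rw [tendstoLocallyUniformly_iff_forall_isCompact] at hlim ⊢
  intro T hT
  refine (hlim T hT).congr ?_
  obtain ⟨ρ, hρ⟩ := hT.isBounded.exists_norm_le
  filter_upwards [(hr.comp hs.tendsto_atTop).eventually_ge_atTop ρ] with n hn x hx
  have h1 := abs_le.1 ((hρ x hx).trans hn)
  simp only [Function.comp] at h1
  simp only
  rw [min_eq_right h1.2, max_eq_right h1.1]

/-- A pointwise limit of solutions of `φ'' - c φ' - d φ + F = 0` on exhausting intervals is a
solution. -/
theorem limit_solves {φ φ' φ'' F : ℕ → ℝ → ℝ} {g G : ℝ → ℝ} {r c : ℕ → ℝ} {c₀ d C M : ℝ}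
    (hφ : ∀ n x, HasDerivAt (φ n) (φ' n x) x) (hφ' : ∀ n x, HasDerivAt (φ' n) (φ'' n x) x)
    (hF : ∀ n, Continuous (F n)) (hr : Tendsto r atTop atTop)
    (heq : ∀ n, ∀ x ∈ Icc (-r n) (r n), φ'' n x - c n * φ' n x - d * φ n x + F n x = 0)
    (hC : ∀ n, ∀ x ∈ Icc (-r n) (r n), |φ n x| ≤ C)
    (hM : ∀ n, ∀ x ∈ Icc (-r n) (r n), |F n x| ≤ M)
    (hc : Tendsto c atTop (𝓝 c₀)) (hg : Continuous g) (hG : Continuous G)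
    (hlim : ∀ x, Tendsto (fun n => φ n x) atTop (𝓝 (g x)))
    (hlimF : ∀ x, Tendsto (fun n => F n x) atTop (𝓝 (G x))) :
    ContDiff ℝ 2 g ∧ ∀ x, deriv (deriv g) x - c₀ * deriv g x - d * g x + G x = 0 := by
  have hφc : ∀ n, Continuous (φ n) := fun n =>
    continuous_iff_continuousAt.2 fun y => (hφ n y).continuousAt
  have hin : ∀ y : ℝ, ∀ᶠ n in atTop, ∀ x ∈ uIcc 0 y, x ∈ Icc (-r n) (r n) := by
    intro y
    filter_upwards [hr.eventually_ge_atTop |y|] with n hn x hx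
    have h1 : |x| ≤ |y| := by simpa using abs_sub_left_of_mem_uIcc hx
    exact abs_le.1 (h1.trans hn)
  -- The equation is integrated twice, so that dominated convergence needs only pointwise limits of
  -- `φ n` and `F n`.
  set J : ℕ → ℝ → ℝ := fun n x => ∫ t in (0 : ℝ)..x, (d * φ n t - F n t) with hJ
  have hJc : ∀ n, Continuous (J n) := fun n => by
    refine intervalIntegral.continuous_primitive (fun a b => ?_) 0
    exact (((hφc n).const_mul d).sub (hF n)).intervalIntegrable a b
  have hφ'eq : ∀ n, ∀ x, (∀ y ∈ uIcc 0 x, y ∈ Icc (-r n) (r n)) →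
      φ' n x = φ' n 0 - c n * φ n 0 + (c n * φ n x + J n x) := by
    intro n x hx
    have h1 := intervalIntegral.integral_eq_sub_of_hasDerivAt (a := 0) (b := x)
      (f := fun t => φ' n t - c n * φ n t) (f' := fun t => d * φ n t - F n t)
      (fun t ht => ((hφ' n t).sub ((hφ n t).const_mul (c n))).congr_deriv (by
        linarith [heq n t (hx t ht)]))
      ((((hφc n).const_mul d).sub (hF n)).intervalIntegrable 0 x)
    simp only [hJ]
    linarith
  set H : ℕ → ℝ → ℝ := fun n x => ∫ t in (0 : ℝ)..x, (c n * φ n t + J n t) with hH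
  have hφeq : ∀ n, ∀ x, (∀ y ∈ uIcc 0 x, y ∈ Icc (-r n) (r n)) →
      φ n x = φ n 0 + (φ' n 0 - c n * φ n 0) * x + H n x := by
    intro n x hx
    have hint := (((hφc n).const_mul (c n)).add (hJc n)).intervalIntegrable
      (μ := MeasureTheory.volume) 0 x
    have h1 := intervalIntegral.integral_eq_sub_of_hasDerivAt (a := 0) (b := x)
      (f := fun t => φ n t - (φ' n 0 - c n * φ n 0) * t) (f' := fun t => c n * φ n t + J n t)
      (fun t ht => ((hφ n t).sub ((hasDerivAt_id t).const_mul _)).congr_deriv (by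
        rw [hφ'eq n t fun y hy => hx y (uIcc_subset_uIcc_left ht hy)]
        ring)) hint
    simp only [hH]
    linarith
  have hbound : ∀ y : ℝ, ∀ᶠ n in atTop, ∀ x ∈ uIcc 0 y, |φ n x| ≤ C ∧ |F n x| ≤ M := by
    intro y
    filter_upwards [hin y] with n hn x hx
    exact ⟨hC n x (hn x hx), hM n x (hn x hx)⟩
  have hJlim : ∀ x, Tendsto (fun n => J n x) atTop (𝓝 (∫ t in (0 : ℝ)..x, (d * g t - G t))) := by
    intro x
    refine intervalIntegral.tendsto_integral_filter_of_dominated_convergence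
      (fun _ => |d| * C + M) (Eventually.of_forall fun n =>
        (((hφc n).const_mul d).sub (hF n)).aestronglyMeasurable) ?_
      intervalIntegrable_const (Eventually.of_forall fun t _ =>
        ((hlim t).const_mul d).sub (hlimF t))
    filter_upwards [hbound x] with n hn
    refine Eventually.of_forall fun t ht => ?_
    obtain ⟨h1, h2⟩ := hn t (uIoc_subset_uIcc ht)
    refine (abs_sub _ _).trans (add_le_add ?_ h2)
    rw [abs_mul]
    gcongr
  set J₀ : ℝ → ℝ := fun x => ∫ t in (0 : ℝ)..x, (d * g t - G t) with hJ₀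
  have hJ₀d : ∀ x, HasDerivAt J₀ (d * g x - G x) x := fun x =>
    ((hg.const_mul d).sub hG).integral_hasStrictDerivAt 0 x |>.hasDerivAt
  have hJ₀c : Continuous J₀ := continuous_iff_continuousAt.2 fun y => (hJ₀d y).continuousAt
  have hHlim : ∀ x, Tendsto (fun n => H n x) atTop
      (𝓝 (∫ t in (0 : ℝ)..x, (c₀ * g t + J₀ t))) := by
    intro x
    refine intervalIntegral.tendsto_integral_filter_of_dominated_convergence
      (fun _ => (|c₀| + 1) * C + (|d| * C + M) * |x|) (Eventually.of_forall fun n =>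
        (((hφc n).const_mul (c n)).add (hJc n)).aestronglyMeasurable) ?_
      intervalIntegrable_const (Eventually.of_forall fun t _ =>
        (hc.mul (hlim t)).add (hJlim t))
    filter_upwards [hbound x, hc.abs.eventually (gt_mem_nhds (lt_add_one |c₀|))] with n hn hcn
    refine Eventually.of_forall fun t ht => ?_
    have ht' := uIoc_subset_uIcc ht
    obtain ⟨h1, h2⟩ := hn t ht'
    refine (norm_add_le _ _).trans (add_le_add ?_ ?_)
    · rw [norm_mul, Real.norm_eq_abs, Real.norm_eq_abs]
      gcongr
    · have hle : ∀ y ∈ uIoc 0 t, ‖d * φ n y - F n y‖ ≤ |d| * C + M := fun y hy => by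
        obtain ⟨h3, h4⟩ := hn y (uIcc_subset_uIcc_left ht' (uIoc_subset_uIcc hy))
        refine (abs_sub _ _).trans (add_le_add ?_ h4)
        rw [abs_mul]
        gcongr
      refine (intervalIntegral.norm_integral_le_of_norm_le_const hle).trans ?_
      have hxt : |t - 0| ≤ |x| := by simpa using abs_sub_left_of_mem_uIcc ht'
      have h0 : 0 ≤ |d| * C + M :=
        add_nonneg (mul_nonneg (abs_nonneg _) ((abs_nonneg _).trans h1)) ((abs_nonneg _).trans h2)
      gcongr
  set H₀ : ℝ → ℝ := fun x => ∫ t in (0 : ℝ)..x, (c₀ * g t + J₀ t) with hH₀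
  have hH₀d : ∀ x, HasDerivAt H₀ (c₀ * g x + J₀ x) x := fun x =>
    ((hg.const_mul c₀).add hJ₀c).integral_hasStrictDerivAt 0 x |>.hasDerivAt
  have hgeq : ∀ x, g x = g 0 + (g 1 - g 0 - H₀ 1) * x + H₀ x := by
    intro x
    -- The coefficient `φ'(0) - cφ(0)` is recovered from the values at `0` and `1`, so convergence
    -- of derivatives is never required.
    refine tendsto_nhds_unique (hlim x) (Tendsto.congr' ?_
      (((hlim 0).add ((((hlim 1).sub (hlim 0)).sub (hHlim 1)).mul_const x)).add (hHlim x)))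
    filter_upwards [hin x, hin 1] with n h1 h2
    have h3 := hφeq n 1 h2
    rw [hφeq n x h1, show φ' n 0 - c n * φ n 0 = φ n 1 - φ n 0 - H n 1 by linarith]
  have hgd : ∀ x, HasDerivAt g ((g 1 - g 0 - H₀ 1) + (c₀ * g x + J₀ x)) x := by
    intro x
    have h1 := (((hasDerivAt_id x).const_mul (g 1 - g 0 - H₀ 1)).const_add (g 0)).add (hH₀d x)
    refine (h1.congr_deriv (by simp)).congr_of_eventuallyEq (Eventually.of_forall fun y => ?_)
    simpa using hgeq y
  have hgd' : deriv g = fun x => (g 1 - g 0 - H₀ 1) + (c₀ * g x + J₀ x) :=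
    funext fun x => (hgd x).deriv
  have hgd2 : ∀ x, HasDerivAt (deriv g) (c₀ * deriv g x + (d * g x - G x)) x := by
    intro x
    rw [hgd']
    exact ((((hgd x).const_mul c₀).add (hJ₀d x)).const_add _)
  have hdc : Continuous (deriv g) := by
    rw [hgd']
    exact continuous_const.add ((hg.const_mul c₀).add hJ₀c)
  refine ⟨?_, fun x => ?_⟩
  · rw [show (2 : WithTop ℕ∞) = 1 + 1 by norm_num, contDiff_succ_iff_deriv]
    refine ⟨fun x => (hgd x).differentiableAt, by simp, ?_⟩
    rw [contDiff_one_iff_deriv]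
    refine ⟨fun x => (hgd2 x).differentiableAt, ?_⟩
    rw [show deriv (deriv g) = fun x => c₀ * deriv g x + (d * g x - G x) from
      funext fun x => (hgd2 x).deriv]
    exact (hdc.const_mul c₀).add ((hg.const_mul d).sub hG)
  · rw [(hgd2 x).deriv]
    ring

/-! ### A delayed boundary value problem -/

/-- The solution of `φ'' - (μ₁ + μ₂) φ' + μ₁ μ₂ φ + F = 0` with `φ a = α`, parametrized by the
coefficient `s` of the growing mode. -/
noncomputable def varConst (μ₁ μ₂ a α s : ℝ) (F : ℝ → ℝ) (x : ℝ) : ℝ :=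
  Real.exp (μ₁ * (x - a)) *
      (α - s + (μ₂ - μ₁)⁻¹ * ∫ t in a..x, Real.exp (-(μ₁ * (t - a))) * F t) +
    Real.exp (μ₂ * (x - a)) *
      (s - (μ₂ - μ₁)⁻¹ * ∫ t in a..x, Real.exp (-(μ₂ * (t - a))) * F t)

theorem varConst_left (μ₁ μ₂ a α s : ℝ) (F : ℝ → ℝ) : varConst μ₁ μ₂ a α s F a = α := by
  simp [varConst]

theorem varConst_congr {μ₁ μ₂ a α s x : ℝ} {F G : ℝ → ℝ} (hx : a ≤ x)
    (h : ∀ t ∈ Icc a x, F t = G t) :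
    varConst μ₁ μ₂ a α s F x = varConst μ₁ μ₂ a α s G x := by
  have key : ∀ μ : ℝ, ∫ t in a..x, Real.exp (-(μ * (t - a))) * F t =
      ∫ t in a..x, Real.exp (-(μ * (t - a))) * G t := fun μ =>
    intervalIntegral.integral_congr fun t ht => by
      rw [uIcc_of_le hx] at ht
      simp only [h t ht]
  unfold varConst
  rw [key, key]

/-- The two modes solve first-order equations with opposite sources `± F / (μ₂ - μ₁)`, which cancel
in the first derivative of the sum. -/
theorem exists_hasDerivAt_varConst {μ₁ μ₂ : ℝ} (h : μ₁ < μ₂) (a α s : ℝ) {F : ℝ → ℝ}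
    (hF : Continuous F) :
    ∃ φ' φ'' : ℝ → ℝ, (∀ x, HasDerivAt (varConst μ₁ μ₂ a α s F) (φ' x) x) ∧
      (∀ x, HasDerivAt φ' (φ'' x) x) ∧
      ∀ x, φ'' x - (μ₁ + μ₂) * φ' x + μ₁ * μ₂ * varConst μ₁ μ₂ a α s F x + F x = 0 := by
  have hD : μ₂ - μ₁ ≠ 0 := by linarith [sub_pos.2 h]
  have hmode : ∀ (μ A κ : ℝ) (x : ℝ), HasDerivAt (fun x => Real.exp (μ * (x - a)) *
      (A + κ * ∫ t in a..x, Real.exp (-(μ * (t - a))) * F t))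
      (μ * (Real.exp (μ * (x - a)) *
      (A + κ * ∫ t in a..x, Real.exp (-(μ * (t - a))) * F t)) + κ * F x) x := by
    intro μ A κ x
    have h1 : HasDerivAt (fun x => Real.exp (μ * (x - a))) (Real.exp (μ * (x - a)) * μ) x := by
      simpa using (((hasDerivAt_id x).sub_const a).const_mul μ).exp
    have hc : Continuous fun t => Real.exp (-(μ * (t - a))) * F t := by fun_prop
    have h2 := ((hc.integral_hasStrictDerivAt a x).hasDerivAt.const_mul κ).const_add A
    refine (h1.mul h2).congr_deriv ?_
    have h3 : Real.exp (μ * (x - a)) * Real.exp (-(μ * (x - a))) = 1 := by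
      rw [← Real.exp_add]; simp
    linear_combination κ * F x * h3
  set u₁ : ℝ → ℝ := fun x => Real.exp (μ₁ * (x - a)) *
      (α - s + (μ₂ - μ₁)⁻¹ * ∫ t in a..x, Real.exp (-(μ₁ * (t - a))) * F t) with hu₁
  set u₂ : ℝ → ℝ := fun x => Real.exp (μ₂ * (x - a)) *
      (s + (-(μ₂ - μ₁)⁻¹) * ∫ t in a..x, Real.exp (-(μ₂ * (t - a))) * F t) with hu₂
  have hsum : varConst μ₁ μ₂ a α s F = fun x => u₁ x + u₂ x := by
    funext x
    simp only [varConst, hu₁, hu₂]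
    ring
  have h1 : ∀ x, HasDerivAt u₁ (μ₁ * u₁ x + (μ₂ - μ₁)⁻¹ * F x) x := hmode μ₁ _ _
  have h2 : ∀ x, HasDerivAt u₂ (μ₂ * u₂ x + -(μ₂ - μ₁)⁻¹ * F x) x := hmode μ₂ _ _
  refine ⟨fun x => μ₁ * u₁ x + μ₂ * u₂ x,
    fun x => μ₁ * (μ₁ * u₁ x + (μ₂ - μ₁)⁻¹ * F x) + μ₂ * (μ₂ * u₂ x + -(μ₂ - μ₁)⁻¹ * F x),
    fun x => ?_, fun x => ((h1 x).const_mul μ₁).add ((h2 x).const_mul μ₂), fun x => ?_⟩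
  · rw [hsum]
    exact ((h1 x).add (h2 x)).congr_deriv (by ring)
  · rw [hsum]
    have h3 : (μ₂ - μ₁) * (μ₂ - μ₁)⁻¹ = 1 := mul_inv_cancel₀ hD
    linear_combination -F x * h3

theorem continuous_varConst {μ₁ μ₂ a α : ℝ} {F : ℝ → ℝ → ℝ}
    (hF : Continuous (Function.uncurry F)) :
    Continuous (Function.uncurry fun s x => varConst μ₁ μ₂ a α s (F s) x) := by
  have key : ∀ μ : ℝ, Continuous fun p : ℝ × ℝ =>
      ∫ t in a..p.2, Real.exp (-(μ * (t - a))) * F p.1 t := fun μ => by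
    refine intervalIntegral.continuous_parametric_intervalIntegral_of_continuous
      (f := fun (p : ℝ × ℝ) t => Real.exp (-(μ * (t - a))) * F p.1 t) ?_ continuous_snd
    have h1 : Continuous fun q : (ℝ × ℝ) × ℝ => F q.1.1 q.2 :=
      hF.comp ((continuous_fst.comp continuous_fst).prodMk continuous_snd)
    exact (by fun_prop : Continuous fun q : (ℝ × ℝ) × ℝ => Real.exp (-(μ * (q.2 - a)))).mul h1
  have h1 := key μ₁
  have h2 := key μ₂
  simp only [Function.uncurry_def, varConst]
  fun_prop

/-- The error bound is uniform in `s` even when the forcing depends on `s`; this gives surjectivity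
in the shooting argument. -/
theorem exists_abs_varConst_sub_le (μ₁ μ₂ α M : ℝ) {a B : ℝ} (haB : a ≤ B) :
    ∃ C : ℝ, ∀ (s : ℝ) (F : ℝ → ℝ), (∀ t, |F t| ≤ M) →
      |varConst μ₁ μ₂ a α s F B -
        (Real.exp (μ₂ * (B - a)) - Real.exp (μ₁ * (B - a))) * s| ≤ C := by
  have key : ∀ (μ : ℝ) (F : ℝ → ℝ), (∀ t, |F t| ≤ M) →
      |∫ t in a..B, Real.exp (-(μ * (t - a))) * F t| ≤
        Real.exp (|μ| * (B - a)) * M * |B - a| := by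
    intro μ F hF
    rw [← Real.norm_eq_abs]
    refine intervalIntegral.norm_integral_le_of_norm_le_const fun t ht => ?_
    rw [uIoc_of_le haB] at ht
    have hM : 0 ≤ M := (abs_nonneg _).trans (hF a)
    rw [norm_mul, Real.norm_eq_abs, Real.norm_eq_abs, Real.abs_exp]
    refine mul_le_mul (Real.exp_le_exp.2 ?_) (hF t) (abs_nonneg _) (Real.exp_pos _).le
    have h1 : -(μ * (t - a)) ≤ |μ| * (t - a) := by
      nlinarith [neg_abs_le μ, ht.1]
    exact h1.trans (mul_le_mul_of_nonneg_left (by linarith [ht.2]) (abs_nonneg _))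
  refine ⟨Real.exp (μ₁ * (B - a)) *
      (|α| + |(μ₂ - μ₁)⁻¹| * (Real.exp (|μ₁| * (B - a)) * M * |B - a|)) +
      Real.exp (μ₂ * (B - a)) *
      (|(μ₂ - μ₁)⁻¹| * (Real.exp (|μ₂| * (B - a)) * M * |B - a|)), fun s F hF => ?_⟩
  have h1 := key μ₁ F hF
  have h2 := key μ₂ F hF
  unfold varConst
  set I₁ := ∫ t in a..B, Real.exp (-(μ₁ * (t - a))) * F t
  set I₂ := ∫ t in a..B, Real.exp (-(μ₂ * (t - a))) * F t
  rw [show Real.exp (μ₁ * (B - a)) * (α - s + (μ₂ - μ₁)⁻¹ * I₁) +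
      Real.exp (μ₂ * (B - a)) * (s - (μ₂ - μ₁)⁻¹ * I₂) -
      (Real.exp (μ₂ * (B - a)) - Real.exp (μ₁ * (B - a))) * s =
      Real.exp (μ₁ * (B - a)) * (α + (μ₂ - μ₁)⁻¹ * I₁) -
      Real.exp (μ₂ * (B - a)) * ((μ₂ - μ₁)⁻¹ * I₂) by ring]
  refine (abs_sub _ _).trans (add_le_add ?_ ?_)
  · rw [abs_mul, Real.abs_exp]
    refine mul_le_mul_of_nonneg_left ((abs_add_le _ _).trans ?_) (Real.exp_pos _).le
    rw [abs_mul]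
    gcongr
  · rw [abs_mul, Real.abs_exp, abs_mul]
    gcongr

/-- A forcing term that depends on the unknown with a positive delay admits a solution of the
two-point boundary value problem: solve forward in time and adjust the growing mode. -/
theorem exists_delayed_bvp {μ₁ μ₂ a B ε M : ℝ} (α β : ℝ) (hμ : μ₁ < μ₂) (haB : a < B) (hε : 0 < ε)
    {𝓕 : (ℝ → ℝ) → ℝ → ℝ}
    (hcausal : ∀ φ ψ t, (∀ x ∈ Icc a (max a (t - ε)), φ x = ψ x) → 𝓕 φ t = 𝓕 ψ t)
    (hcont : ∀ Φ : ℝ → ℝ → ℝ, Continuous (Function.uncurry Φ) →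
      Continuous (Function.uncurry fun s t => 𝓕 (Φ s) t))
    (hbd : ∀ φ t, |𝓕 φ t| ≤ M) :
    ∃ φ φ' φ'' F : ℝ → ℝ, (∀ x, HasDerivAt φ (φ' x) x) ∧ (∀ x, HasDerivAt φ' (φ'' x) x) ∧
      Continuous F ∧ φ a = α ∧ φ B = β ∧
      (∀ x, φ'' x - (μ₁ + μ₂) * φ' x + μ₁ * μ₂ * φ x + F x = 0) ∧
      ∀ t ∈ Icc a B, F t = 𝓕 φ t := by
  -- Method of steps: the forcing at `t` sees the unknown only up to `t - ε`, so each iteration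
  -- extends the correct solution by `ε`, starting from the single point `a`.
  let Φ : ℕ → ℝ → ℝ → ℝ := fun n => n.rec (fun _ _ => α)
    fun _ Ψ s => varConst μ₁ μ₂ a α s (𝓕 (Ψ s))
  have hsucc : ∀ n s, Φ (n + 1) s = varConst μ₁ μ₂ a α s (𝓕 (Φ n s)) := fun n s => rfl
  have hΦc : ∀ n, Continuous (Function.uncurry (Φ n)) := by
    intro n
    induction n with
    | zero => exact continuous_const
    | succ n ih => exact continuous_varConst (F := fun s => 𝓕 (Φ n s)) (hcont _ ih)
  have hstab : ∀ (n : ℕ) s, ∀ x ∈ Icc a (a + n * ε), Φ n s x = Φ (n + 1) s x := by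
    intro n s
    induction n with
    | zero =>
      intro x hx
      have hxa : x = a := le_antisymm (by simpa using hx.2) hx.1
      rw [hxa, hsucc, varConst_left]
      rfl
    | succ n ih =>
      intro x hx
      rw [hsucc, hsucc (n + 1)]
      refine varConst_congr hx.1 fun t ht => hcausal _ _ _ fun y hy => ih y ⟨hy.1, hy.2.trans ?_⟩
      have hx2 := hx.2
      push_cast at hx2
      refine max_le (by have : 0 ≤ n * ε := by positivity
                        linarith) ?_
      linarith [ht.2]
  obtain ⟨n, hn⟩ := exists_nat_ge ((B - a) / ε)
  rw [div_le_iff₀ hε] at hn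
  obtain ⟨C, hC⟩ := exists_abs_varConst_sub_le μ₁ μ₂ α M haB.le
  have hκ : 0 < Real.exp (μ₂ * (B - a)) - Real.exp (μ₁ * (B - a)) :=
    sub_pos.2 (Real.exp_lt_exp.2 (mul_lt_mul_of_pos_right hμ (sub_pos.2 haB)))
  -- The value at `B` is continuous in `s` and within bounded distance of a linear function with
  -- positive slope.
  have hsurj : Function.Surjective fun s => Φ (n + 1) s B := by
    refine Continuous.surjective ?_ ?_ ?_
    · exact (hΦc (n + 1)).comp (continuous_id.prodMk continuous_const)
    · refine tendsto_atTop_mono (fun s => ?_)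
        (tendsto_atTop_add_const_right _ (-C) (tendsto_id.const_mul_atTop hκ))
      have := (abs_le.1 (hC s _ (hbd (Φ n s)))).1
      simp only [hsucc, id]
      linarith
    · refine tendsto_atBot_mono (fun s => ?_)
        (tendsto_atBot_add_const_right _ C (tendsto_id.const_mul_atBot hκ))
      have := (abs_le.1 (hC s _ (hbd (Φ n s)))).2
      simp only [hsucc, id]
      linarith
  obtain ⟨s, hs⟩ := hsurj β
  have hFc : Continuous (𝓕 (Φ n s)) :=
    (hcont _ (hΦc n)).comp (continuous_const.prodMk continuous_id)
  obtain ⟨φ', φ'', h1, h2, h3⟩ := exists_hasDerivAt_varConst hμ a α s hFc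
  refine ⟨Φ (n + 1) s, φ', φ'', 𝓕 (Φ n s), h1, h2, hFc, varConst_left _ _ _ _ _ _, hs, h3, ?_⟩
  intro t ht
  refine hcausal _ _ _ fun y hy => hstab n s y ⟨hy.1, hy.2.trans (max_le (by linarith [haB]) ?_)⟩
  linarith [ht.2]

/-! ### Barriers and the truncated problem -/

noncomputable def upperBarrier (U l x : ℝ) : ℝ := min (Real.exp (l * x)) U

/-- Here `l` is the smaller characteristic root and `γ ∈ (l, 2l)` lies below the larger one, so
`e^{γx}` is a strict correction that dominates quadratic errors for `x ≤ 0`. -/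
noncomputable def lowerBarrier (q l γ x : ℝ) : ℝ :=
  max 0 (Real.exp (l * x) - q * Real.exp (γ * x))

/-- Projection onto the interval between the barriers at `x`. -/
noncomputable def barrierProj (U q l γ x y : ℝ) : ℝ :=
  max (lowerBarrier q l γ x) (min (upperBarrier U l x) y)

/-- The forcing term with all values of the unknown projected between the barriers and read with
an additional delay `ε` and not before `a`. -/
noncomputable def truncForcing (b τ : ℝ → ℝ) (c U q l γ a ε : ℝ) (φ : ℝ → ℝ) (t : ℝ) : ℝ :=
  -- The barriers are taken at the delayed time without the shift `ε` and without the cutoff at `a`,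
  -- so the bounds on the forcing do not depend on either.
  b (barrierProj U q l γ (t - c * τ (barrierProj U q l γ t (φ (max a (t - ε)))))
    (φ (max a (t - c * τ (barrierProj U q l γ t (φ (max a (t - ε)))) - ε))))

theorem barrierProj_nonneg (U q l γ x y : ℝ) : 0 ≤ barrierProj U q l γ x y :=
  (le_max_left _ _).trans (le_max_left _ _)

theorem lowerBarrier_le_barrierProj (U q l γ x y : ℝ) :
    Real.exp (l * x) - q * Real.exp (γ * x) ≤ barrierProj U q l γ x y :=
  (le_max_right _ _).trans (le_max_left _ _)

theorem barrierProj_eq {U q l γ x y : ℝ} (h1 : lowerBarrier q l γ x ≤ y)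
    (h2 : y ≤ upperBarrier U l x) : barrierProj U q l γ x y = y := by
  rw [barrierProj, min_eq_right h2, max_eq_right h1]

theorem continuous_barrierProj (U q l γ : ℝ) :
    Continuous fun p : ℝ × ℝ => barrierProj U q l γ p.1 p.2 := by
  unfold barrierProj lowerBarrier upperBarrier
  fun_prop

theorem exp_sub_mul_exp_nonpos {q l γ x : ℝ} (hq : 1 ≤ q) (hlγ : l ≤ γ) (hx : 0 ≤ x) :
    Real.exp (l * x) - q * Real.exp (γ * x) ≤ 0 := by
  have h1 : Real.exp (l * x) ≤ Real.exp (γ * x) := by gcongr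
  have h2 : 1 * Real.exp (γ * x) ≤ q * Real.exp (γ * x) := by gcongr
  linarith

/-- For `x < 0` and `y = e^{lx}` the lower barrier is at most `max(0, y - qy²)`, and `y - qy² ≤
1/(4q) ≤ U`; for `x ≥ 0` it is zero. -/
theorem lowerBarrier_le_upperBarrier {U q l γ : ℝ} (hU : 0 < U) (hq : 1 ≤ q) (hqU : 1 ≤ q * U)
    (hlγ : l ≤ γ) (hγ : γ ≤ 2 * l) (x : ℝ) : lowerBarrier q l γ x ≤ upperBarrier U l x := by
  have hq0 : 0 ≤ q * Real.exp (γ * x) := by positivity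
  refine max_le (le_min (Real.exp_pos _).le hU.le) (le_min (by linarith) ?_)
  rcases le_or_gt 0 x with h | h
  · exact (exp_sub_mul_exp_nonpos hq hlγ h).trans hU.le
  · have h1 : Real.exp (l * x) ^ 2 ≤ Real.exp (γ * x) := by
      rw [← Real.exp_nat_mul]
      apply Real.exp_le_exp.2
      push_cast
      nlinarith
    set y := Real.exp (l * x)
    have h2 : q * y ^ 2 ≤ q * Real.exp (γ * x) := by gcongr
    have h3 : 0 ≤ q := by linarith
    nlinarith [sq_nonneg (q * y - 1), sq_nonneg (y - U), mul_nonneg h3 (sq_nonneg (y - U)),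
      mul_nonneg (sub_nonneg.2 hqU) hU.le, Real.exp_pos (l * x)]

section Truncated

variable {d K : ℝ} {b τ : ℝ → ℝ} {c q l γ : ℝ}

theorem barrierProj_le_upperBarrier {U x : ℝ} (h : lowerBarrier q l γ x ≤ upperBarrier U l x)
    (y : ℝ) : barrierProj U q l γ x y ≤ upperBarrier U l x :=
  max_le h (min_le_left _ _)

/-- Bounds on the birth rate at a value between the barriers at the delayed time. -/
theorem birth_bounds (hb : BirthAssumptions d K b) {L m σ t u : ℝ} (hL : 0 ≤ L) (hc : 0 ≤ c)
    (hl : 0 ≤ l) (hγ : 0 ≤ γ) (hq : 0 ≤ q) (hm : 0 ≤ m)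
    (hquad : ∀ u, 0 ≤ u → derivWithin b (Ici 0) 0 * u - L * u ^ 2 ≤ b u)
    (hσ : m ≤ σ) (hσ' : σ ≤ m + Real.exp (l * t)) (hu : 0 ≤ u)
    (hu1 : u ≤ Real.exp (l * (t - c * σ)))
    (hu2 : Real.exp (l * (t - c * σ)) - q * Real.exp (γ * (t - c * σ)) ≤ u) :
    b u ≤ derivWithin b (Ici 0) 0 * Real.exp (l * (t - c * m)) ∧
    derivWithin b (Ici 0) 0 * Real.exp (l * (t - c * m)) -
      derivWithin b (Ici 0) 0 * q * Real.exp (γ * (t - c * m)) -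
      (derivWithin b (Ici 0) 0 * l * c + L) * Real.exp (l * t) ^ 2 ≤ b u := by
  set p := derivWithin b (Ici 0) 0
  have hp : 0 ≤ p := (hb.d_pos.trans hb.d_lt_deriv_zero).le
  have hcσ : c * m ≤ c * σ := by gcongr
  have hexp : ∀ r : ℝ, 0 ≤ r → Real.exp (r * (t - c * σ)) ≤ Real.exp (r * (t - c * m)) :=
    fun r hr => Real.exp_le_exp.2 (mul_le_mul_of_nonneg_left (by linarith) hr)
  refine ⟨(hb.le_linear hu).trans (mul_le_mul_of_nonneg_left (hu1.trans (hexp l hl)) hp), ?_⟩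
  have h1 : u ≤ Real.exp (l * t) := hu1.trans <|
    Real.exp_le_exp.2 (mul_le_mul_of_nonneg_left (by nlinarith [mul_nonneg hc hm]) hl)
  have h2 : L * u ^ 2 ≤ L * Real.exp (l * t) ^ 2 := by gcongr
  have h3 : Real.exp (l * (t - c * m)) - l * c * Real.exp (l * t) ^ 2 ≤
      Real.exp (l * (t - c * σ)) := by
    have h4 : Real.exp (l * (t - c * σ)) =
        Real.exp (l * (t - c * m)) * Real.exp (-(l * c * (σ - m))) := by
      rw [← Real.exp_add]; congr 1; ring
    have h5 : 1 - l * c * Real.exp (l * t) ≤ Real.exp (-(l * c * (σ - m))) := by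
      have h6 := Real.add_one_le_exp (-(l * c * (σ - m)))
      have h7 : l * c * (σ - m) ≤ l * c * Real.exp (l * t) := by
        have := mul_nonneg hl hc
        gcongr
        linarith
      linarith
    have h8 : Real.exp (l * (t - c * m)) ≤ Real.exp (l * t) :=
      Real.exp_le_exp.2 (mul_le_mul_of_nonneg_left (by nlinarith [mul_nonneg hc hm]) hl)
    rw [h4]
    have h9 := mul_le_mul_of_nonneg_left h5 (Real.exp_pos (l * (t - c * m))).le
    have h10 : l * c * Real.exp (l * t) * Real.exp (l * (t - c * m)) ≤
        l * c * Real.exp (l * t) * Real.exp (l * t) := by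
      have := mul_nonneg hl hc
      gcongr
    nlinarith
  have h11 := mul_le_mul_of_nonneg_left (hexp γ hγ) hq
  have h12 := mul_le_mul_of_nonneg_left (show Real.exp (l * (t - c * m)) -
    l * c * Real.exp (l * t) ^ 2 - q * Real.exp (γ * (t - c * m)) ≤ u by linarith) hp
  have h13 := hquad u hu
  nlinarith

/-- A solution with forcing between the appropriate bounds stays between the barriers. -/
theorem between_barriers {φ φ' φ'' F : ℝ → ℝ} {p m L U a B : ℝ} (hd : 0 < d)
    (hlγ : l ≤ γ) (hγl : γ ≤ 2 * l) (hq : 1 ≤ q) (haB : a ≤ B)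
    (hroot : charFn d p m l c = 0)
    (hqγ : p * l * c + L ≤ q * -charFn d p m γ c) (hpL : 0 ≤ p * l * c + L)
    (hφ : ∀ x, HasDerivAt φ (φ' x) x) (hφ' : ∀ x, HasDerivAt φ' (φ'' x) x)
    (heq : ∀ x, φ'' x - c * φ' x - d * φ x + F x = 0)
    (ha : lowerBarrier q l γ a ≤ φ a ∧ φ a ≤ upperBarrier U l a)
    (hB : lowerBarrier q l γ B ≤ φ B ∧ φ B ≤ upperBarrier U l B)
    (h0 : ∀ t ∈ Icc a B, 0 ≤ F t) (hU : ∀ t ∈ Icc a B, F t ≤ d * U)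
    (hup : ∀ t ∈ Icc a B, F t ≤ p * Real.exp (l * (t - c * m)))
    (hlo : ∀ t ∈ Icc a B, p * Real.exp (l * (t - c * m)) - p * q * Real.exp (γ * (t - c * m)) -
      (p * l * c + L) * Real.exp (l * t) ^ 2 ≤ F t) :
    ∀ x ∈ Icc a B, lowerBarrier q l γ x ≤ φ x ∧ φ x ≤ upperBarrier U l x := by
  have hexp : ∀ r x : ℝ, HasDerivAt (fun x => Real.exp (r * x)) (r * Real.exp (r * x)) x :=
    fun r x => by simpa [mul_comm] using ((hasDerivAt_id x).const_mul r).exp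
  have hexp' : ∀ r x : ℝ, HasDerivAt (fun x => r * Real.exp (r * x))
      (r * (r * Real.exp (r * x))) x := fun r x => (hexp r x).const_mul r
  have hshift : ∀ r t : ℝ, Real.exp (r * (t - c * m)) =
      Real.exp (-(r * c * m)) * Real.exp (r * t) := fun r t => by
    rw [← Real.exp_add]; congr 1; ring
  have P1 : ∀ x ∈ Icc a B, 0 ≤ φ x :=
    nonneg_of_supersolution (c := c) hd haB hφ hφ'
      (fun x hx _ => by linarith [heq x, h0 x (Ioo_subset_Icc_self hx)])
      ((le_max_left _ _).trans ha.1) ((le_max_left _ _).trans hB.1)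
  have P2 : ∀ x ∈ Icc a B, 0 ≤ U - φ x :=
    nonneg_of_supersolution (c := c) hd haB (fun x => (hφ x).const_sub U)
      (fun x => (hφ' x).neg)
      (fun x hx _ => by linarith [heq x, hU x (Ioo_subset_Icc_self hx)])
      (sub_nonneg.2 (ha.2.trans (min_le_right _ _))) (sub_nonneg.2 (hB.2.trans (min_le_right _ _)))
  have P3 : ∀ x ∈ Icc a B, 0 ≤ Real.exp (l * x) - φ x := by
    refine nonneg_of_supersolution (c := c) hd haB (fun x => (hexp l x).sub (hφ x))
      (fun x => (hexp' l x).sub (hφ' x)) (fun x hx _ => ?_)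
      (sub_nonneg.2 (ha.2.trans (min_le_left _ _))) (sub_nonneg.2 (hB.2.trans (min_le_left _ _)))
    have h1 := hup x (Ioo_subset_Icc_self hx)
    rw [hshift] at h1
    unfold charFn at hroot
    have h2 := heq x
    have h3 : (l ^ 2 - c * l - d + p * Real.exp (-(l * c * m))) * Real.exp (l * x) = 0 := by
      rw [hroot, zero_mul]
    linarith
  have P4 : ∀ x ∈ Icc a B, 0 ≤ φ x - (Real.exp (l * x) - q * Real.exp (γ * x)) := by
    refine nonneg_of_supersolution (c := c) hd haB
      (fun x => (hφ x).sub ((hexp l x).sub ((hexp γ x).const_mul q)))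
      (fun x => (hφ' x).sub ((hexp' l x).sub ((hexp' γ x).const_mul q))) (fun x hx hneg => ?_)
      (sub_nonneg.2 ((le_max_right _ _).trans ha.1)) (sub_nonneg.2 ((le_max_right _ _).trans hB.1))
    -- Since `φ ≥ 0`, the inequality can fail only for negative `x`, and there `e^{2lx} ≤ e^{γx}`
    -- lets the `q` term absorb the quadratic errors.
    have hx0 : x < 0 := by
      by_contra! h
      have := exp_sub_mul_exp_nonpos hq hlγ h
      have := P1 x (Ioo_subset_Icc_self hx)
      linarith
    have h1 := hlo x (Ioo_subset_Icc_self hx)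
    rw [hshift, hshift γ] at h1
    have h2 := heq x
    have h3 : (l ^ 2 - c * l - d + p * Real.exp (-(l * c * m))) * Real.exp (l * x) = 0 := by
      unfold charFn at hroot
      rw [hroot, zero_mul]
    have h4 : Real.exp (l * x) ^ 2 ≤ Real.exp (γ * x) := by
      rw [← Real.exp_nat_mul]
      apply Real.exp_le_exp.2
      push_cast
      nlinarith
    have h5 := mul_le_mul_of_nonneg_left h4 hpL
    have h6 := mul_le_mul_of_nonneg_right hqγ (Real.exp_pos (γ * x)).le
    unfold charFn at h6
    linarith
  intro x hx
  exact ⟨max_le (P1 x hx) (by linarith [P4 x hx]),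
    le_min (by linarith [P3 x hx]) (by linarith [P2 x hx])⟩

/-- Because of the projection, the forcing bounds hold for every input; the solution is placed
between the barriers only afterwards, by comparison. -/
theorem exists_truncated_solution (hb : BirthAssumptions d K b) (hτ : DelayAssumptions τ)
    {L a B ε : ℝ} (hL : 0 ≤ L)
    (hquad : ∀ u, 0 ≤ u → derivWithin b (Ici 0) 0 * u - L * u ^ 2 ≤ b u)
    (hc : 0 ≤ c) (hl : 0 < l) (hlγ : l ≤ γ) (hγl : γ ≤ 2 * l) (hq : 1 ≤ q)
    (hqU : 1 ≤ q * upperLevel d K b) (haB : a < B) (hε : 0 < ε)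
    (hroot : charFn d (derivWithin b (Ici 0) 0) (τ 0) l c = 0)
    (hqγ : derivWithin b (Ici 0) 0 * l * c + L ≤
      q * -charFn d (derivWithin b (Ici 0) 0) (τ 0) γ c) :
    ∃ φ φ' φ'' F : ℝ → ℝ, (∀ x, HasDerivAt φ (φ' x) x) ∧ (∀ x, HasDerivAt φ' (φ'' x) x) ∧
      Continuous F ∧ (∀ x, φ'' x - c * φ' x - d * φ x + F x = 0) ∧
      (∀ x ∈ Icc a B, lowerBarrier q l γ x ≤ φ x ∧ φ x ≤ upperBarrier (upperLevel d K b) l x) ∧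
      (∀ t ∈ Icc a B, 0 ≤ F t ∧ F t ≤ d * upperLevel d K b) ∧
      ∀ t ∈ Icc a B, F t = truncForcing b τ c (upperLevel d K b) q l γ a ε φ t := by
  set U := upperLevel d K b with hUdef
  have hU : 0 < U := hb.K_pos.trans_le hb.K_le_upperLevel
  have hd := hb.d_pos
  have hp : 0 < derivWithin b (Ici 0) 0 := hd.trans hb.d_lt_deriv_zero
  have hbar := fun x => lowerBarrier_le_upperBarrier hU hq hqU hlγ hγl x
  have hproj : ∀ x y, barrierProj U q l γ x y ≤ upperBarrier U l x := fun x y =>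
    barrierProj_le_upperBarrier (hbar x) y
  have hF0 : ∀ φ t, 0 ≤ truncForcing b τ c U q l γ a ε φ t := fun φ t =>
    hb.nonneg _ (barrierProj_nonneg _ _ _ _ _ _)
  have hFU : ∀ φ t, truncForcing b τ c U q l γ a ε φ t ≤ d * U := fun φ t =>
    hb.le_upperLevel (barrierProj_nonneg _ _ _ _ _ _) ((hproj _ _).trans (min_le_right _ _))
  obtain ⟨μ₁, μ₂, hμ₁, hμ₂, hs, hpr⟩ := exists_roots c hd
  have hprojc := continuous_barrierProj U q l γ
  have hτc : Continuous fun p : ℝ × ℝ => τ (barrierProj U q l γ p.1 p.2) :=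
    hτ.contDiffOn.continuousOn.comp_continuous hprojc fun p => barrierProj_nonneg _ _ _ _ _ _
  have hbc : Continuous fun p : ℝ × ℝ => b (barrierProj U q l γ p.1 p.2) :=
    hb.continuousOn.comp_continuous hprojc fun p => barrierProj_nonneg _ _ _ _ _ _
  have hcausal : ∀ φ ψ t, (∀ x ∈ Icc a (max a (t - ε)), φ x = ψ x) →
      truncForcing b τ c U q l γ a ε φ t = truncForcing b τ c U q l γ a ε ψ t := by
    intro φ ψ t h
    have h1 : φ (max a (t - ε)) = ψ (max a (t - ε)) := h _ ⟨le_max_left _ _, le_rfl⟩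
    unfold truncForcing
    rw [h1]
    congr 2
    refine h _ ⟨le_max_left _ _, max_le_max le_rfl ?_⟩
    have := mul_nonneg hc
      (hτ.nonneg _ (barrierProj_nonneg U q l γ t (ψ (max a (t - ε)))))
    linarith
  have hcont : ∀ Φ : ℝ → ℝ → ℝ, Continuous (Function.uncurry Φ) →
      Continuous (Function.uncurry fun s t => truncForcing b τ c U q l γ a ε (Φ s) t) := by
    intro Φ hΦ
    have h1 : Continuous fun p : ℝ × ℝ => Φ p.1 (max a (p.2 - ε)) :=
      hΦ.comp (continuous_fst.prodMk
        (by fun_prop : Continuous fun p : ℝ × ℝ => max a (p.2 - ε)))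
    have h2 : Continuous fun p : ℝ × ℝ =>
        p.2 - c * τ (barrierProj U q l γ p.2 (Φ p.1 (max a (p.2 - ε)))) :=
      continuous_snd.sub ((hτc.comp (continuous_snd.prodMk h1)).const_mul c)
    have h3 : Continuous fun p : ℝ × ℝ => Φ p.1 (max a
        (p.2 - c * τ (barrierProj U q l γ p.2 (Φ p.1 (max a (p.2 - ε)))) - ε)) :=
      hΦ.comp (continuous_fst.prodMk (continuous_const.max (h2.sub continuous_const)))
    exact hbc.comp (h2.prodMk h3)
  have hbd : ∀ φ t, |truncForcing b τ c U q l γ a ε φ t| ≤ d * U := by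
    intro φ t
    rw [abs_of_nonneg (hF0 φ t)]
    exact hFU φ t
  obtain ⟨φ, φ', φ'', F, hφ, hφ', hFc, hφa, hφB, heq, hFeq⟩ := exists_delayed_bvp
    (upperBarrier U l a) (upperBarrier U l B) (hμ₁.trans hμ₂) haB hε hcausal hcont hbd
  have heq' : ∀ x, φ'' x - c * φ' x - d * φ x + F x = 0 := fun x => by
    have := heq x
    rw [hs, hpr] at this
    linarith
  have hbounds := fun t (ht : t ∈ Icc a B) => birth_bounds (q := q) (l := l) (γ := γ) (t := t) hb
    hL hc hl.le (hl.le.trans hlγ) (by linarith) (hτ.nonneg 0 le_rfl) hquad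
    (hτ.zero_le_apply (barrierProj_nonneg U q l γ t (φ (max a (t - ε)))))
    ((hτ.apply_le (barrierProj_nonneg U q l γ t (φ (max a (t - ε))))).trans
      (add_le_add_right ((hproj _ _).trans (min_le_left _ _)) _))
    (barrierProj_nonneg U q l γ _
      (φ (max a (t - c * τ (barrierProj U q l γ t (φ (max a (t - ε)))) - ε))))
    ((hproj _ _).trans (min_le_left _ _)) (lowerBarrier_le_barrierProj _ _ _ _ _ _)
  refine ⟨φ, φ', φ'', F, hφ, hφ', hFc, heq', ?_, fun t ht => ?_, hFeq⟩
  · refine between_barriers hd hlγ hγl hq haB.le hroot hqγ (by positivity) hφ hφ' heq'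
      (by rw [hφa]; exact ⟨hbar a, le_rfl⟩) (by rw [hφB]; exact ⟨hbar B, le_rfl⟩)
      (fun t ht => ?_) (fun t ht => ?_) (fun t ht => ?_) (fun t ht => ?_)
    · rw [hFeq t ht]; exact hF0 _ _
    · rw [hFeq t ht]; exact hFU _ _
    · rw [hFeq t ht]; exact (hbounds t ht).1
    · rw [hFeq t ht]; exact (hbounds t ht).2
  · rw [hFeq t ht]; exact ⟨hF0 _ _, hFU _ _⟩

end Truncated

/-! ### Existence of waves above the threshold speed -/

section Waves

variable {d K : ℝ} {b τ : ℝ → ℝ}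

theorem continuous_delayed_birth (hb : BirthAssumptions d K b) (hτ : DelayAssumptions τ) (c : ℝ)
    {g : ℝ → ℝ} (hg : Continuous g) (h0 : ∀ x, 0 ≤ g x) :
    Continuous fun x => b (g (x - c * τ (g x))) := by
  have h1 : Continuous fun x => τ (g x) := hτ.contDiffOn.continuousOn.comp_continuous hg h0
  exact hb.continuousOn.comp_continuous (hg.comp (continuous_id.sub (h1.const_mul c)))
    fun x => h0 _

theorem exists_wave (hb : BirthAssumptions d K b) (hτ : DelayAssumptions τ) {c l l₂ : ℝ}
    (hc : 0 ≤ c) (hl : 0 < l) (hl₂ : l < l₂)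
    (hroot : charFn d (derivWithin b (Ici 0) 0) (τ 0) l c = 0)
    (hneg : ∀ x, l < x → x < l₂ → charFn d (derivWithin b (Ici 0) 0) (τ 0) x c < 0) :
    ∃ φ : ℝ → ℝ, IsWaveProfile d b τ c φ ∧ (∀ x, 0 ≤ φ x) ∧ (∀ x, φ x ≤ upperLevel d K b) ∧
      (∃ x, φ x ≠ 0) ∧ Tendsto φ atBot (𝓝 0) := by
  set U := upperLevel d K b with hUdef
  set p := derivWithin b (Ici 0) 0 with hpdef
  have hU : 0 < U := hb.K_pos.trans_le hb.K_le_upperLevel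
  have hd := hb.d_pos
  have hp : 0 < p := hd.trans hb.d_lt_deriv_zero
  obtain ⟨L, hL, hquad⟩ := hb.exists_quadratic_le
  obtain ⟨γ, hγ1, hγ2⟩ := exists_between (lt_min hl₂ (by linarith : l < 2 * l))
  have hΛ := hneg γ hγ1 (hγ2.trans_le (min_le_left _ _))
  have hγl : γ ≤ 2 * l := (hγ2.trans_le (min_le_right _ _)).le
  have hpL : 0 ≤ p * l * c + L := by positivity
  set Λ := charFn d p (τ 0) γ c
  -- The three summands secure `q ≥ 1`, `qU ≥ 1` and the absorption inequality `hqγ`.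
  set q := 1 + 1 / U + (p * l * c + L) / (-Λ) with hqdef
  have hΛ' : 0 < -Λ := by linarith
  have hU1 : 0 < 1 / U := by positivity
  have hr1 : 0 ≤ (p * l * c + L) / (-Λ) := by positivity
  have hq : 1 ≤ q := by linarith
  have hqU : 1 ≤ q * U := by
    have h1 : 1 / U * U ≤ q * U := by gcongr; linarith
    rwa [one_div, inv_mul_cancel₀ hU.ne'] at h1
  have hqγ : p * l * c + L ≤ q * -Λ := by
    rw [← div_le_iff₀ hΛ']
    linarith
  have hn1 : ∀ n : ℕ, (0 : ℝ) < n + 1 := fun n => by positivity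
  have hsol := fun n : ℕ => exists_truncated_solution hb hτ (a := -((n : ℝ) + 1))
    (B := (n : ℝ) + 1) (ε := 1 / ((n : ℝ) + 1)) hL.le hquad hc hl hγ1.le hγl hq hqU
    (by linarith [hn1 n]) (by have := hn1 n; positivity) hroot hqγ
  choose φ φ' φ'' F hφ hφ' hFc heq hbar hF hFeq using hsol
  have hbar' : ∀ n : ℕ, ∀ x ∈ Icc (-((n : ℝ) + 1)) (n + 1), 0 ≤ φ n x ∧ φ n x ≤ U :=
    fun n x hx => ⟨(le_max_left _ _).trans (hbar n x hx).1, (hbar n x hx).2.trans (min_le_right _ _)⟩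
  have hsub : ∀ n : ℕ, Icc (-(n : ℝ)) n ⊆ Icc (-((n : ℝ) + 1)) (n + 1) := fun n =>
    Icc_subset_Icc (by linarith) (by linarith)
  -- The derivative bound looks one unit ahead, hence the margin between radius `n` and radius `n +
  -- 1`.
  have hsub' : ∀ n : ℕ, ∀ x ∈ Icc (-(n : ℝ)) n, Icc x (x + 1) ⊆ Icc (-((n : ℝ) + 1)) (n + 1) :=
    fun n x hx => Icc_subset_Icc (by linarith [hx.1]) (by linarith [hx.2])
  obtain ⟨s, g, hs, hg, hlim⟩ := exists_subseq_tendstoLocallyUniformly (r := fun n : ℕ => (n : ℝ))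
    (C := U) (R := 2 * U + 2 * |c| * U + d * U) hφ
    (fun n => n.cast_nonneg) tendsto_natCast_atTop_atTop
    (fun n x hx => by
      obtain ⟨h1, h2⟩ := hbar' n x (hsub n hx)
      exact abs_le.2 ⟨by linarith, h2⟩)
    (fun n x hx => abs_deriv_le (hφ n) (hφ' n)
      (fun y hy => by
        obtain ⟨h1, h2⟩ := hbar' n y (hsub' n x hx hy)
        exact abs_le.2 ⟨by linarith, h2⟩)
      (fun y hy => by
        obtain ⟨h1, h2⟩ := hbar' n y (hsub' n x hx hy)
        obtain ⟨h3, h4⟩ := hF n y (hsub' n x hx hy)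
        have h5 := heq n y
        have h6 : d * φ n y ≤ d * U := by gcongr
        have h7 : 0 ≤ d * φ n y := by positivity
        exact abs_le.2 ⟨by linarith, by linarith⟩))
  have hscast : Tendsto (fun n => (s n : ℝ)) atTop atTop :=
    tendsto_natCast_atTop_atTop.comp hs.tendsto_atTop
  have hpt : ∀ x, Tendsto (fun n => φ (s n) x) atTop (𝓝 (g x)) := fun x =>
    hlim.tendsto_comp hg.continuousAt tendsto_const_nhds
  have hin : ∀ x : ℝ, ∀ᶠ n in atTop, x ∈ Icc (-((s n : ℝ) + 1)) (s n + 1) := by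
    intro x
    filter_upwards [hscast.eventually_ge_atTop |x|] with n hn
    exact abs_le.1 (by linarith)
  have hgbar : ∀ x, lowerBarrier q l γ x ≤ g x ∧ g x ≤ upperBarrier U l x := fun x =>
    ⟨ge_of_tendsto (hpt x) ((hin x).mono fun n hn => (hbar _ _ hn).1),
      le_of_tendsto (hpt x) ((hin x).mono fun n hn => (hbar _ _ hn).2)⟩
  have hg0 : ∀ x, 0 ≤ g x := fun x => (le_max_left _ _).trans (hgbar x).1
  have hgproj : ∀ x, barrierProj U q l γ x (g x) = g x := fun x =>
    barrierProj_eq (hgbar x).1 (hgbar x).2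
  have hprojc := continuous_barrierProj U q l γ
  have hτc : Continuous fun p : ℝ × ℝ => τ (barrierProj U q l γ p.1 p.2) :=
    hτ.contDiffOn.continuousOn.comp_continuous hprojc fun p => barrierProj_nonneg _ _ _ _ _ _
  have hbc : Continuous fun p : ℝ × ℝ => b (barrierProj U q l γ p.1 p.2) :=
    hb.continuousOn.comp_continuous hprojc fun p => barrierProj_nonneg _ _ _ _ _ _
  have hε : Tendsto (fun n => 1 / ((s n : ℝ) + 1)) atTop (𝓝 0) :=
    tendsto_one_div_add_atTop_nhds_zero_nat.comp hs.tendsto_atTop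
  have hmax : ∀ (x : ℝ) (z : ℕ → ℝ), Tendsto z atTop (𝓝 x) →
      Tendsto (fun n => φ (s n) (max (-((s n : ℝ) + 1)) (z n - 1 / ((s n : ℝ) + 1)))) atTop
        (𝓝 (g x)) := by
    intro x z hz
    have h1 : Tendsto (fun n => z n - 1 / ((s n : ℝ) + 1)) atTop (𝓝 x) := by
      simpa using hz.sub hε
    refine hlim.tendsto_comp hg.continuousAt (h1.congr' ?_)
    filter_upwards [h1.eventually (lt_mem_nhds (sub_one_lt x)),
      hscast.eventually_ge_atTop (-x)] with n h2 h3
    rw [max_eq_right (by linarith)]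
  have hlimF : ∀ x, Tendsto (fun n => F (s n) x) atTop (𝓝 (b (g (x - c * τ (g x))))) := by
    intro x
    have h1 := hmax x (fun _ => x) tendsto_const_nhds
    have h2 := (hτc.tendsto (x, g x)).comp (tendsto_const_nhds.prodMk_nhds h1)
    simp only [hgproj] at h2
    have h3 := (tendsto_const_nhds (x := x)).sub (h2.const_mul c)
    have h4 := (hbc.tendsto (x - c * τ (g x), g (x - c * τ (g x)))).comp
      (h3.prodMk_nhds (hmax _ _ h3))
    simp only [hgproj] at h4
    refine h4.congr' ?_
    filter_upwards [hin x] with n hn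
    rw [hFeq _ _ hn]
    rfl
  refine ⟨g, limit_solves (r := fun n => (s n : ℝ)) (c := fun _ => c) (C := U) (M := d * U)
    (fun n => hφ (s n)) (fun n => hφ' (s n)) (fun n => hFc (s n)) hscast
    (fun n x _ => heq (s n) x) (fun n x hx => ?_) (fun n x hx => ?_) tendsto_const_nhds hg
    (continuous_delayed_birth hb hτ c hg hg0) hpt hlimF, hg0,
    fun x => (hgbar x).2.trans (min_le_right _ _), ?_, ?_⟩
  · obtain ⟨h1, h2⟩ := hbar' _ x (hsub _ hx)
    exact abs_le.2 ⟨by linarith, h2⟩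
  · obtain ⟨h1, h2⟩ := hF _ x (hsub _ hx)
    exact abs_le.2 ⟨by linarith, h2⟩
  · have hγl0 : 0 < γ - l := by linarith
    -- At this point `e^{(γ-l)x} = e^{-q}`, and `q e^{-q} < 1` makes the lower barrier positive.
    refine ⟨-(q / (γ - l)), fun h => ?_⟩
    have h1 := (le_max_right _ _).trans (hgbar (-(q / (γ - l)))).1
    rw [h] at h1
    have h2 : Real.exp (γ * -(q / (γ - l))) = Real.exp (l * -(q / (γ - l))) * Real.exp (-q) := by
      rw [← Real.exp_add]
      congr 1
      field_simp
      ring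
    have h3 : q * Real.exp (-q) < 1 := by
      rw [Real.exp_neg, ← div_eq_mul_inv, div_lt_one (Real.exp_pos q)]
      linarith [Real.add_one_le_exp q]
    rw [h2] at h1
    nlinarith [Real.exp_pos (l * -(q / (γ - l)))]
  · refine squeeze_zero hg0 (fun x => (hgbar x).2.trans (min_le_left _ _)) ?_
    exact Real.tendsto_exp_atBot.comp (tendsto_id.const_mul_atBot hl)

/-! ### Properties of wave profiles -/

namespace IsWaveProfile

variable {c : ℝ} {φ : ℝ → ℝ}

theorem hasDerivAt (h : IsWaveProfile d b τ c φ) (x : ℝ) : HasDerivAt φ (deriv φ x) x :=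
  (h.1.differentiable (by norm_num) x).hasDerivAt

theorem hasDerivAt_deriv (h : IsWaveProfile d b τ c φ) (x : ℝ) :
    HasDerivAt (deriv φ) (deriv (deriv φ) x) x := by
  have h1 := h.1
  rw [show (2 : WithTop ℕ∞) = 1 + 1 by norm_num, contDiff_succ_iff_deriv] at h1
  exact (h1.2.2.differentiable (by norm_num) x).hasDerivAt

theorem continuous (h : IsWaveProfile d b τ c φ) : Continuous φ := h.1.continuous

theorem comp_add_const (h : IsWaveProfile d b τ c φ) (y : ℝ) :
    IsWaveProfile d b τ c fun x => φ (x + y) := by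
  refine ⟨h.1.comp (contDiff_id.add contDiff_const), fun x => ?_⟩
  have h1 : (deriv fun x => φ (x + y)) = fun x => deriv φ (x + y) :=
    funext fun x => deriv_comp_add_const _ _ _
  rw [h1, deriv_comp_add_const]
  have h2 := h.2 (x + y)
  rw [show x + y - c * τ (φ (x + y)) = x - c * τ (φ (x + y)) + y by ring] at h2
  exact h2

theorem pos (h : IsWaveProfile d b τ c φ) (hb : BirthAssumptions d K b) (h0 : ∀ x, 0 ≤ φ x)
    (hne : ∃ x, φ x ≠ 0) : ∀ x, 0 < φ x := by
  intro x
  refine lt_of_le_of_ne (h0 x) fun hx => ?_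
  obtain ⟨y, hy⟩ := hne
  exact hy (eq_zero_of_supersolution (c := c) hb.d_pos h.hasDerivAt h.hasDerivAt_deriv
    (fun z => by linarith [h.2 z, hb.nonneg _ (h0 (z - c * τ (φ z)))]) h0 hx.symm y)

end IsWaveProfile

/-- Wave profiles with convergent speeds converge locally uniformly along a subsequence. -/
theorem exists_limit_wave (hb : BirthAssumptions d K b) (hτ : DelayAssumptions τ)
    {φ : ℕ → ℝ → ℝ} {c : ℕ → ℝ} {c₀ : ℝ} (hφ : ∀ n, IsWaveProfile d b τ (c n) (φ n))
    (h0 : ∀ n x, 0 ≤ φ n x) (hU : ∀ n x, φ n x ≤ upperLevel d K b)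
    (hc : Tendsto c atTop (𝓝 c₀)) :
    ∃ (s : ℕ → ℕ) (g : ℝ → ℝ), StrictMono s ∧ IsWaveProfile d b τ c₀ g ∧
      TendstoLocallyUniformly (fun n => φ (s n)) g atTop := by
  set U := upperLevel d K b
  have hd := hb.d_pos
  have hUpos : 0 ≤ U := (h0 0 0).trans (hU 0 0)
  obtain ⟨A, hA⟩ := hc.abs.bddAbove_range
  have hcA : ∀ n, |c n| ≤ A := fun n => hA (mem_range_self n)
  have habs : ∀ n x, |φ n x| ≤ U := fun n x => by rw [abs_of_nonneg (h0 n x)]; exact hU n x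
  have hF : ∀ n x, 0 ≤ b (φ n (x - c n * τ (φ n x))) ∧ b (φ n (x - c n * τ (φ n x))) ≤ d * U :=
    fun n x => ⟨hb.nonneg _ (h0 _ _), hb.le_upperLevel (h0 _ _) (hU _ _)⟩
  obtain ⟨s, g, hs, hg, hlim⟩ := exists_subseq_tendstoLocallyUniformly (r := fun n : ℕ => (n : ℝ))
    (C := U) (R := 2 * U + 2 * A * U + d * U) (fun n => (hφ n).hasDerivAt)
    (fun n => n.cast_nonneg) tendsto_natCast_atTop_atTop (fun n x _ => habs n x) (fun n x _ => by
      refine (abs_deriv_le (C := U) (M := d * U) (c := c n) (hφ n).hasDerivAt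
        (hφ n).hasDerivAt_deriv (fun y _ => habs n y) fun y _ => ?_).trans ?_
      · obtain ⟨h3, h4⟩ := hF n y
        have h5 := (hφ n).2 y
        have h6 : d * φ n y ≤ d * U := by gcongr; exact hU n y
        have h7 : 0 ≤ d * φ n y := mul_nonneg hd.le (h0 n y)
        exact abs_le.2 ⟨by linarith, by linarith⟩
      · have := hcA n
        gcongr)
  have hpt : ∀ x, Tendsto (fun n => φ (s n) x) atTop (𝓝 (g x)) := fun x =>
    hlim.tendsto_comp hg.continuousAt tendsto_const_nhds
  have hg0 : ∀ x, 0 ≤ g x := fun x => ge_of_tendsto' (hpt x) fun n => h0 _ _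
  have hcs := hc.comp hs.tendsto_atTop
  have hwithin : ∀ {z : ℕ → ℝ} {y : ℝ}, Tendsto z atTop (𝓝 y) → (∀ n, 0 ≤ z n) →
      Tendsto z atTop (𝓝[Ici 0] y) := fun hz hz0 =>
    tendsto_nhdsWithin_iff.2 ⟨hz, Eventually.of_forall hz0⟩
  have hlimF : ∀ x, Tendsto (fun n => b (φ (s n) (x - c (s n) * τ (φ (s n) x)))) atTop
      (𝓝 (b (g (x - c₀ * τ (g x))))) := by
    intro x
    have h1 : Tendsto (fun n => τ (φ (s n) x)) atTop (𝓝 (τ (g x))) :=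
      (hτ.contDiffOn.continuousOn (g x) (hg0 x)).tendsto.comp (hwithin (hpt x) fun n => h0 _ _)
    have h2 := (tendsto_const_nhds (x := x)).sub (hcs.mul h1)
    have h3 := hlim.tendsto_comp hg.continuousAt h2
    exact (hb.continuousOn _ (hg0 _)).tendsto.comp (hwithin h3 fun n => h0 _ _)
  exact ⟨s, g, hs, limit_solves (C := U) (M := d * U) (c := fun n => c (s n))
    (fun n => (hφ (s n)).hasDerivAt)
    (fun n => (hφ (s n)).hasDerivAt_deriv)
    (fun n => continuous_delayed_birth hb hτ (c (s n)) (hφ (s n)).continuous (h0 (s n)))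
    (tendsto_natCast_atTop_atTop (R := ℝ)) (fun n x _ => (hφ (s n)).2 x) (fun n x _ => habs _ _)
    (fun n x _ => by rw [abs_of_nonneg (hF _ _).1]; exact (hF _ _).2) hcs hg
    (continuous_delayed_birth hb hτ c₀ hg hg0) hpt hlimF, hlim⟩

end Waves

/-! ### Persistence at `+∞` -/

section Persistence

variable {d K : ℝ} {b τ : ℝ → ℝ} {c k : ℝ} {φ : ℝ → ℝ}

namespace IsWaveProfile

theorem birth_le_of_left_min (h : IsWaveProfile d b τ c φ) {a x : ℝ} (hax : a < x)
    (h0 : deriv φ x = 0) (hmin : ∀ y ∈ Icc a x, φ x ≤ φ y) :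
    b (φ (x - c * τ (φ x))) ≤ d * φ x := by
  have h1 := second_deriv_nonneg_of_left_min h.hasDerivAt (h.hasDerivAt_deriv x) h0 hax hmin
  have h2 := h.2 x
  rw [h0] at h2
  linarith

/-- A lower bound below the level `k` on a window of the length of the delay persists. -/
theorem le_of_le_on_window (h : IsWaveProfile d b τ c φ) (hb : BirthAssumptions d K b)
    (hτ : DelayAssumptions τ) (hk : IsLowerLevel d K b k) (hc : 0 ≤ c) (hpos : ∀ x, 0 < φ x)
    (hU : ∀ x, φ x ≤ upperLevel d K b) {T D θ : ℝ} (hD : ∀ x, c * τ (φ x) ≤ D) (hθk : θ ≤ k)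
    (hθ : ∀ x ∈ Icc T (T + D), θ ≤ φ x) : ∀ y, T ≤ y → θ ≤ φ y := by
  intro y hTy
  by_contra! hy
  have hdelay0 : ∀ x, 0 ≤ c * τ (φ x) := fun x => mul_nonneg hc (hτ.nonneg _ (hpos x).le)
  have hD0 : 0 ≤ D := (hdelay0 0).trans (hD 0)
  -- Past the window the delayed argument still lies in `[T, z]`, so at a running minimum below `k`
  -- birth strictly exceeds death.
  have key : ∀ z, T + D < z → (∀ t ∈ Icc T z, φ z ≤ φ t) → φ z < k →
      d * φ z < b (φ (z - c * τ (φ z))) := by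
    intro z hz hmin hzk
    by_contra! hle
    exact absurd (hb.lowerLevel_le hk (hpos z) (hmin (z - c * τ (φ z))
      ⟨by linarith [hD z], by linarith [hdelay0 z]⟩) (hU _) hle) (not_le.2 hzk)
  -- The minimum over `[T, x]` is neither in the window nor at an interior critical point, so it
  -- sits at `x`. Thus `φ` decreases beyond `y`, the equation makes it strictly concave there, and
  -- it would have to become nonpositive.
  have hrec : ∀ x, y ≤ x → T + D < x ∧ (∀ t ∈ Icc T x, φ x ≤ φ t) ∧ φ x < k := by
    intro x hx
    obtain ⟨z, hz, hmin⟩ := isCompact_Icc.exists_isMinOn (nonempty_Icc.2 (hTy.trans hx))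
      h.continuous.continuousOn
    have hzy : φ z ≤ φ y := hmin ⟨hTy, hx⟩
    have hzD : T + D < z := by
      by_contra! hle
      linarith [hθ z ⟨hz.1, hle⟩]
    have hzmin : ∀ t ∈ Icc T z, φ z ≤ φ t := fun t ht => hmin ⟨ht.1, ht.2.trans hz.2⟩
    rcases hz.2.eq_or_lt with rfl | hzx
    · exact ⟨hzD, hzmin, by linarith⟩
    · have hloc : IsLocalMin φ z := hmin.isLocalMin (Icc_mem_nhds (by linarith) hzx)
      have h1 := h.birth_le_of_left_min (by linarith) hloc.deriv_eq_zero hzmin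
      linarith [key z hzD hzmin (by linarith)]
  have hanti : AntitoneOn φ (Ioi y) := fun u hu v hv huv =>
    (hrec v (le_of_lt hv)).2.1 u ⟨hTy.trans (le_of_lt hu), huv⟩
  have hder : ∀ x ∈ Ioi y, deriv φ x ≤ 0 := fun x hx => by
    rw [← derivWithin_of_isOpen isOpen_Ioi hx]
    exact hanti.derivWithin_nonpos
  have hder2 : ∀ x ∈ Ioi y, deriv (deriv φ) x < 0 := fun x hx => by
    obtain ⟨h1, h2, h3⟩ := hrec x (le_of_lt hx)
    have h4 := key x h1 h2 h3
    have h5 := h.2 x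
    have h6 := mul_nonpos_of_nonneg_of_nonpos hc (hder x hx)
    linarith
  have hsanti : StrictAntiOn (deriv φ) (Ioi y) :=
    strictAntiOn_of_deriv_neg (convex_Ioi y)
      (fun x _ => (h.hasDerivAt_deriv x).continuousAt.continuousWithinAt)
      (fun x hx => hder2 x (by rwa [interior_Ioi] at hx))
  have hneg : deriv φ (y + 2) < 0 :=
    (hsanti (by simp : y + 1 ∈ Ioi y) (by simp : y + 2 ∈ Ioi y) (by linarith)).trans_le
      (hder _ (by simp))
  set m := deriv φ (y + 2)
  have hle := (convex_Ici (y + 2)).image_sub_le_mul_sub_of_deriv_le h.continuous.continuousOn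
    (fun x _ => (h.hasDerivAt x).differentiableAt.differentiableWithinAt) (C := m)
    (fun x hx => by
      rw [interior_Ici] at hx
      have hx' : y + 2 < x := hx
      exact (hsanti.antitoneOn) (by simp) (by simp only [mem_Ioi]; linarith) hx'.le)
    -- This is where the tangent line at `y + 2` reaches zero.
    (y + 2) self_mem_Ici (y + 2 + φ (y + 2) / -m)
    (by simp only [mem_Ici]; linarith [div_nonneg (hpos (y + 2)).le (neg_pos.2 hneg).le])
    (by linarith [div_nonneg (hpos (y + 2)).le (neg_pos.2 hneg).le])
  have h1 : m * (y + 2 + φ (y + 2) / -m - (y + 2)) = -φ (y + 2) := by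
    field_simp [hneg.ne]
    ring
  linarith [hpos (y + 2 + φ (y + 2) / -m)]

theorem isBoundedUnder_le (hU : ∀ x, φ x ≤ upperLevel d K b) :
    IsBoundedUnder (· ≤ ·) atTop φ := isBoundedUnder_of ⟨_, hU⟩

theorem isBoundedUnder_ge (hpos : ∀ x, 0 < φ x) : IsBoundedUnder (· ≥ ·) atTop φ :=
  isBoundedUnder_of ⟨0, fun x => (hpos x).le⟩

theorem le_liminf (h : IsWaveProfile d b τ c φ) (hb : BirthAssumptions d K b)
    (hτ : DelayAssumptions τ) (hk : IsLowerLevel d K b k) (hc : 0 ≤ c) (hpos : ∀ x, 0 < φ x)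
    (hU : ∀ x, φ x ≤ upperLevel d K b) : k ≤ liminf φ atTop := by
  have hbd1 := isBoundedUnder_le hU
  have hbd2 := isBoundedUnder_ge hpos
  set D := c * (τ 0 + upperLevel d K b) with hDdef
  have hD : ∀ x, c * τ (φ x) ≤ D := fun x =>
    mul_le_mul_of_nonneg_left ((hτ.apply_le (hpos x).le).trans
      (add_le_add_right (hU x) _)) hc
  have hD0 : 0 ≤ D := (mul_nonneg hc (hτ.nonneg _ (hpos 0).le)).trans (hD 0)
  set l := liminf φ atTop with hl
  -- Positivity comes first: without it the limit of translates could be zero, and `lowerLevel_le`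
  -- would not apply.
  have hlpos : 0 < l := by
    obtain ⟨z, -, hz⟩ := isCompact_Icc.exists_isMinOn
      (nonempty_Icc.2 (by linarith : (0 : ℝ) ≤ 0 + D)) h.continuous.continuousOn
    have h1 := h.le_of_le_on_window hb hτ hk hc hpos hU hD (min_le_right (φ z) k)
      fun x hx => (min_le_left _ _).trans (hz hx)
    exact (lt_min (hpos z) hk.1).trans_le (le_liminf_of_le hbd1.isCoboundedUnder_ge
      ((eventually_ge_atTop 0).mono fun x hx => h1 x hx))
  have hseq : ∀ n : ℕ, ∃ x : ℝ, (n : ℝ) ≤ x ∧ φ x < l + 1 / ((n : ℝ) + 1) := fun n => by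
    have h1 : l < l + 1 / ((n : ℝ) + 1) := by
      have : 0 < 1 / ((n : ℝ) + 1) := by positivity
      linarith
    have h2 := frequently_lt_of_liminf_lt hbd1.isCoboundedUnder_ge h1
    obtain ⟨x, hx1, hx2⟩ := (h2.and_eventually (eventually_ge_atTop (n : ℝ))).exists
    exact ⟨x, hx2, hx1⟩
  choose x hxn hx using hseq
  -- The liminf need not be attained by `φ`, but the limit of translates attains it at the origin as
  -- a global minimum.
  obtain ⟨s, g, hs, hg, hlim⟩ := exists_limit_wave hb hτ (φ := fun n y => φ (y + x n))
    (c := fun _ => c) (fun n => h.comp_add_const (x n)) (fun n y => (hpos _).le) (fun n y => hU _)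
    tendsto_const_nhds
  have hpt : ∀ y, Tendsto (fun n => φ (y + x (s n))) atTop (𝓝 (g y)) := fun y =>
    hlim.tendsto_comp hg.continuous.continuousAt tendsto_const_nhds
  have hxs : Tendsto (fun n => x (s n)) atTop atTop :=
    tendsto_atTop_mono (fun n => hxn (s n)) (tendsto_natCast_atTop_atTop.comp hs.tendsto_atTop)
  have hgl : ∀ y, l ≤ g y := fun y => by
    refine le_of_forall_lt fun r hr => ?_
    obtain ⟨r', h1, h2⟩ := exists_between hr
    refine h1.trans_le (ge_of_tendsto (hpt y) ?_)
    have h3 := (eventually_lt_of_lt_liminf h2 hbd2)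
    exact ((tendsto_atTop_add_const_left _ y hxs).eventually h3).mono fun n hn => hn.le
  have hg0 : g 0 = l := by
    refine le_antisymm ?_ (hgl 0)
    have h1 : Tendsto (fun n => l + 1 / ((s n : ℝ) + 1)) atTop (𝓝 (l + 0)) :=
      (tendsto_one_div_add_atTop_nhds_zero_nat.comp hs.tendsto_atTop).const_add l
    rw [add_zero] at h1
    exact le_of_tendsto_of_tendsto' (hpt 0) h1 fun n => by simpa using (hx (s n)).le
  have hgmin : ∀ y, g 0 ≤ g y := fun y => hg0 ▸ hgl y
  have hloc : IsLocalMin g 0 := Eventually.of_forall hgmin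
  have hle := hg.birth_le_of_left_min (a := -1) (by norm_num) hloc.deriv_eq_zero
    fun y _ => hgmin y
  rw [← hg0]
  exact hb.lowerLevel_le hk (hg0 ▸ hlpos) (hgmin _)
    (le_of_tendsto' (hpt _) fun n => hU _) hle

theorem limitsBetween (h : IsWaveProfile d b τ c φ) (hb : BirthAssumptions d K b)
    (hτ : DelayAssumptions τ) (hk : IsLowerLevel d K b k) (hc : 0 ≤ c) (hpos : ∀ x, 0 < φ x)
    (hU : ∀ x, φ x ≤ upperLevel d K b) : LimitsBetween k (upperLevel d K b) φ := by
  have hbd1 := isBoundedUnder_le hU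
  have hbd2 := isBoundedUnder_ge hpos
  exact ⟨hbd1, hbd2, h.le_liminf hb hτ hk hc hpos hU, liminf_le_limsup hbd1 hbd2,
    limsup_le_of_le hbd2.isCoboundedUnder_le (Eventually.of_forall hU)⟩

end IsWaveProfile

/-- Above the threshold speed there are waves normalized at the origin. -/
theorem exists_normalized_wave (hb : BirthAssumptions d K b) (hτ : DelayAssumptions τ)
    {cstar : ℝ} (hcs : IsCriticalSpeed d (derivWithin b (Ici 0) 0) (τ 0) cstar)
    (hk : IsLowerLevel d K b k) (hc : cstar < c) :
    ∃ φ : ℝ → ℝ, IsWaveProfile d b τ c φ ∧ (∀ x, 0 < φ x) ∧ (∀ x, φ x ≤ upperLevel d K b) ∧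
      Tendsto φ atBot (𝓝 0) ∧ φ 0 = k / 2 := by
  obtain ⟨l, l₂, hl, hl₂, hroot, -, hneg, -⟩ := hcs.above c hc
  have hc0 : 0 ≤ c := hcs.pos.le.trans hc.le
  obtain ⟨φ, hφ, h0, hU, hne, hbot⟩ := exists_wave hb hτ hc0 hl hl₂ hroot hneg
  have hpos := hφ.pos hb h0 hne
  have hk2 : 0 < k / 2 := by linarith [hk.1]
  obtain ⟨y, hy⟩ := (eventually_lt_of_lt_liminf ((by linarith : k / 2 < k).trans_le
    (hφ.le_liminf hb hτ hk hc0 hpos hU)) (IsWaveProfile.isBoundedUnder_ge hpos)).exists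
  obtain ⟨z, hz⟩ := (hbot.eventually (gt_mem_nhds hk2)).exists
  obtain ⟨x, hx⟩ := mem_range_of_exists_le_of_exists_ge hφ.continuous ⟨z, hz.le⟩ ⟨y, hy.le⟩
  exact ⟨fun t => φ (t + x), hφ.comp_add_const x, fun t => hpos _, fun t => hU _,
    hbot.comp (tendsto_atBot_add_const_right _ x tendsto_id), by simpa using hx⟩

end Persistence

/-! ### Passage to the threshold speed. -/

theorem theorem3p3 (d K : ℝ) (b τ : ℝ → ℝ)
    (hb : BirthAssumptions d K b) (hτ : DelayAssumptions τ) :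
    (∃! cstar : ℝ, IsCriticalSpeed d (derivWithin b (Set.Ici 0) 0) (τ 0) cstar) ∧
    (∃! k : ℝ, IsLowerLevel d K b k) ∧
    ∀ cstar k : ℝ,
      IsCriticalSpeed d (derivWithin b (Set.Ici 0) 0) (τ 0) cstar →
      IsLowerLevel d K b k →
      ∀ c : ℕ → ℝ, Antitone c → (∀ n, cstar < c n) →
        Filter.Tendsto c Filter.atTop (nhds cstar) →
        ∃ φ : ℝ → ℝ,
          IsWaveProfile d b τ cstar φ ∧
          (∀ ξ, 0 < φ ξ) ∧
          (∃ ξ η, φ ξ ≠ φ η) ∧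
          LimitsBetween k (upperLevel d K b) φ ∧
          ∃ (s : ℕ → ℕ) (Φ : ℕ → ℝ → ℝ),
            StrictMono s ∧
            (∀ n, IsWaveProfile d b τ (c (s n)) (Φ n) ∧
              (∀ ξ, 0 < Φ n ξ) ∧
              Filter.Tendsto (Φ n) Filter.atBot (nhds 0) ∧
              LimitsBetween k (upperLevel d K b) (Φ n)) ∧
            TendstoLocallyUniformly Φ φ Filter.atTop := by
  refine ⟨existsUnique_isCriticalSpeed hb.d_pos hb.d_lt_deriv_zero (hτ.nonneg 0 le_rfl),
    hb.existsUnique_isLowerLevel, ?_⟩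
  intro cstar k hcs hk c _ hc hclim
  choose Ψ hΨ hpos hU hbot hnorm using fun n => exists_normalized_wave hb hτ hcs hk (hc n)
  obtain ⟨s, φ, hs, hφ, hlim⟩ := exists_limit_wave hb hτ hΨ (fun n x => (hpos n x).le) hU hclim
  have hpt : ∀ x, Tendsto (fun n => Ψ (s n) x) atTop (𝓝 (φ x)) := fun x =>
    hlim.tendsto_comp hφ.continuous.continuousAt tendsto_const_nhds
  have hφ0 : φ 0 = k / 2 := tendsto_nhds_unique (hpt 0) (by simp only [hnorm, tendsto_const_nhds])
  have hφpos := hφ.pos hb (fun x => ge_of_tendsto' (hpt x) fun n => (hpos _ x).le)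
    ⟨0, by rw [hφ0]; exact (half_pos hk.1).ne'⟩
  have hφU : ∀ x, φ x ≤ upperLevel d K b := fun x => le_of_tendsto' (hpt x) fun n => hU _ x
  -- Bounds at infinity do not pass to locally uniform limits, so persistence is applied to the
  -- limit wave itself.
  have hbetween := hφ.limitsBetween hb hτ hk hcs.pos.le hφpos hφU
  refine ⟨φ, hφ, hφpos, ?_, hbetween, s, fun n => Ψ (s n), hs, fun n => ⟨hΨ _, hpos _, hbot _,
    (hΨ _).limitsBetween hb hτ hk (hcs.pos.le.trans (hc _).le) (hpos _) (hU _)⟩, hlim⟩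
  obtain ⟨y, hy⟩ := (eventually_lt_of_lt_liminf ((half_lt_self hk.1).trans_le hbetween.2.2.1)
    hbetween.2.1).exists
  exact ⟨0, y, by rw [hφ0]; exact hy.ne⟩
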